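/- Let $\Gamma$ be a graph with finitely many vertices, finitely many interior edges $e$ of finite lengths $a_e>0$ ($p$ of them), and finitely many (but at least one) semi-infinite rays; put $n=$ number of rays. Let $q$ be a real potential on $\Gamma$, continuous on every closed edge and every ray, with $\int_0^\infty(1+x)|q(x)|\,dx<\infty$ on every ray. At each vertex $v$, of degree $d(v)$, fix a self-adjoint boundary condition, i.e. a Lagrange plane in the space $\mathbb C^{2d(v)}$ of values and derivatives (in the direction away from $v$) at the $d(v)$ edge ends meeting at $v$, with respect to the form $\sum(\bar\phi\psi'-\bar\phi'\psi)$. Let $\mathcal L=-\frac{d^2}{dx^2}+q$ be the corresponding Schrödinger operator in $H(\Gamma)=\bigoplus_{\rm rays}L^2([0,\infty))\oplus\bigoplus_e L^2([0,a_e])$. Split $\Gamma$ into stars: cut every interior edge $e$ at a point $c_e\in[0,a_e]$ and replace each of the two halves by a ray, measured from its vertex, carrying the potential of that half up to the cut and $0$ beyond it (solutions on rays are $C^1$, and satisfy the equation except at the possible jump of the potential). Every vertex $v$ thereby becomes a star $\Gamma_v$ with $d(v)$ rays, with the potentials just described and the boundary condition of $v$. Let $k\in\mathbb R\setminus\{0\}$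 and $\lambda=k^2$. On each ray $j$ let $f_{\pm,j}$ be the Jost solutions, $-f''+qf=k^2f$, $f_{\pm,j}(x)e^{\mp ikx}\to1$ as $x\to\infty$. The scattering matrix $S_v$ of $\Gamma_v$ is the $d(v)\times d(v)$ matrix such that for each ray $i$ of $\Gamma_v$ the function $f_{-,i}+\sum_j (S_v)_{ij}f_{+,j}$ satisfies the boundary condition at $v$. Put $m=2p+n$, and list the $m$ rays of all the stars as: first halves of the interior edges, second halves of the interior edges, original rays of $\Gamma$. Let $S_{(m)}$ be the matrix with entries those of the $S_v$ for two rays of the same star $\Gamma_v$, and $0$ for rays of different stars. Let $\zeta$ be the diagonal $p\times p$ matrix with entries $e^{-ika_e}$, and $$T_{(m)}=\begin{pmatrix}0&\zeta&0\\ \zeta&0&0\\0&0&\mathbb I_{(n)}\end{pmatrix},\qquad g(U)=\frac12\begin{pmatrix}U+\mathbb I&i(U-\mathbb I)\\-i(U-\mathbb I)&U+\mathbb I\end{pmatrix},\qquad h=g(S_{(m)})\,g(T_{(m)})^{\star}=\begin{pmatrix}A_{(m)}&B_{(m)}\\-B_{(m)}&A_{(m)}\end{pmatrix},$$ and let $B_{(2p)}=B_{(2p)}(k)$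 be the upper left $2p\times2p$ block of $B_{(m)}$. Then, for every real $k\ne0$: each scattering matrix $S_v$ exists and is unique; $\lambda=k^2$ lies in the continuous spectrum of $\mathcal L$ (the set of $\lambda$ for which the range of $\mathcal L-\lambda$ is not closed); and $$\det B_{(2p)}(k)=0\iff \lambda=k^2\text{ is an eigenvalue of }\mathcal L\text{ (with eigenfunction in }H(\Gamma))\text{ embedded in the continuous spectrum of }\mathcal L .$$ -/

import Mathlib

open MeasureTheory Filter Topology

/-- The hermitian symplectic form `∑ (conj φ · ψ' - conj φ' · ψ)` on boundary data: to each edge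
end `h` belongs the pair (value, derivative pointing away from the vertex). -/
noncomputable def boundaryForm {ι : Type*} [Fintype ι] (φ ψ : ι → ℂ × ℂ) : ℂ :=
  ∑ h, (star (φ h).1 * (ψ h).2 - star (φ h).2 * (ψ h).1)

/-- A Lagrange plane: a subspace equal to its own orthogonal complement for the form. -/
def IsLagrangePlane {ι : Type*} [Fintype ι] (P : Submodule ℂ (ι → ℂ × ℂ)) : Prop :=
  ∀ φ : ι → ℂ × ℂ, φ ∈ P ↔ ∀ ψ ∈ P, boundaryForm φ ψ = 0

/-- `f` solves `-f'' + q f = lam f` on the interval `s`, with continuous first derivative `f'`.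
The equation may fail at finitely many points, where `q` may jump; where `q` is continuous on `s`
this is the same as being a classical `C²` solution. -/
def IsSolution (q : ℝ → ℝ) (lam : ℝ) (s : Set ℝ) (f f' : ℝ → ℂ) : Prop :=
  (∀ x ∈ s, HasDerivWithinAt f (f' x) s x) ∧ ContinuousOn f' s ∧
    ∃ F : Set ℝ, F.Finite ∧
      ∀ x ∈ s \ F, HasDerivWithinAt f' (((q x : ℂ) - (lam : ℂ)) * f x) s x

/-- The Jost solution on a ray with asymptotic behaviour `f x ≃ exp (i k x)`, at energy `k ^ 2`. -/
def IsJost (q : ℝ → ℝ) (k : ℝ) (f : ℝ → ℂ) : Prop :=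
  (∃ f' : ℝ → ℂ, IsSolution q (k ^ 2) (Set.Ici 0) f f') ∧
    Tendsto (fun x : ℝ => f x * Complex.exp (-(Complex.I * k * x))) atTop (𝓝 1)

/-- A metric graph with vertices `V`, interior edges `E` (of finite length) and semi-infinite
rays `R`, with a real potential on every edge and ray, and self-adjoint (Lagrangian) boundary
conditions at every vertex.

The edge ends are `(E ⊕ E) ⊕ R`: `inl (inl e)` is the end `x = 0` of the edge `e`,
`inl (inr e)` is its end `x = len e`, and `inr r` is the end `x = 0` of the ray `r`.
Loops and multiple edges are allowed. -/
structure SchrodingerGraph (V E R : Type*) [Fintype E] [Fintype R] [DecidableEq V] where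
  /-- lengths of the interior edges -/
  len : E → ℝ
  len_pos : ∀ e, 0 < len e
  /-- the vertex at which an edge end is attached -/
  vtx : (E ⊕ E) ⊕ R → V
  /-- the potentials -/
  q : E ⊕ R → ℝ → ℝ
  /-- the boundary condition at a vertex -/
  bc : ∀ v : V, Submodule ℂ ({h : (E ⊕ E) ⊕ R // vtx h = v} → ℂ × ℂ)
  bc_lagrange : ∀ v, IsLagrangePlane (bc v)

namespace SchrodingerGraph

variable {V E R : Type*} [Fintype E] [Fintype R] [DecidableEq V]

/-- The interval `[0, len e]` of an interior edge, `[0, ∞)` of a ray. -/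
def interval (Γ : SchrodingerGraph V E R) : E ⊕ R → Set ℝ
  | Sum.inl e => Set.Icc 0 (Γ.len e)
  | Sum.inr _ => Set.Ici 0

/-- The potentials are continuous, and on the rays integrable with finite first moment
(which is automatic on the interior edges). -/
def RegularPotentials (Γ : SchrodingerGraph V E R) : Prop :=
  (∀ i, ContinuousOn (Γ.q i) (Γ.interval i)) ∧
    ∀ r : R, IntegrableOn (fun x => (1 + x) * |Γ.q (Sum.inr r) x|) (Set.Ici 0)

/-- The value at an edge end, and the derivative there in the direction away from the vertex, of
a function `u` on the graph with derivative `u'`. -/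
def boundaryData (Γ : SchrodingerGraph V E R) (u u' : E ⊕ R → ℝ → ℂ) : (E ⊕ E) ⊕ R → ℂ × ℂ
  | Sum.inl (Sum.inl e) => (u (Sum.inl e) 0, u' (Sum.inl e) 0)
  | Sum.inl (Sum.inr e) => (u (Sum.inl e) (Γ.len e), -u' (Sum.inl e) (Γ.len e))
  | Sum.inr r => (u (Sum.inr r) 0, u' (Sum.inr r) 0)

/-- `u` satisfies the boundary condition at every vertex. -/
def VertexConditions (Γ : SchrodingerGraph V E R) (u u' : E ⊕ R → ℝ → ℂ) : Prop :=
  ∀ v : V, (fun h : {h : (E ⊕ E) ⊕ R // Γ.vtx h = v} => Γ.boundaryData u u' h) ∈ Γ.bc v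

/-- Generalised eigenfunctions (not necessarily square integrable). -/
def IsGeneralizedEigenfunction (Γ : SchrodingerGraph V E R) (lam : ℝ)
    (u u' : E ⊕ R → ℝ → ℂ) : Prop :=
  (∀ i, IsSolution (Γ.q i) lam (Γ.interval i) (u i) (u' i)) ∧ Γ.VertexConditions u u'

/-- `S` is the scattering matrix at momentum `k`: for every ray `i` there is a generalised
eigenfunction which is `f₋ᵢ + ∑ⱼ S i j f₊ⱼ` on the rays, with `f₊`, `f₋` the Jost solutions. -/
def IsScatteringMatrix [DecidableEq R] (Γ : SchrodingerGraph V E R) (k : ℝ)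
    (S : Matrix R R ℂ) : Prop :=
  ∃ fp fm : R → ℝ → ℂ,
    (∀ r, IsJost (Γ.q (Sum.inr r)) k (fp r)) ∧ (∀ r, IsJost (Γ.q (Sum.inr r)) (-k) (fm r)) ∧
    ∀ i : R, ∃ u u' : E ⊕ R → ℝ → ℂ, Γ.IsGeneralizedEigenfunction (k ^ 2) u u' ∧
      ∀ j : R, ∀ x : ℝ, 0 ≤ x →
        u (Sum.inr j) x = (if j = i then fm j x else 0) + S i j * fp j x

/-! ### The operator in the Hilbert space of the graph -/

/-- The Hilbert space `⊕ L²(edge) ⊕ L²(ray)`. -/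
abbrev HilbertSpace (Γ : SchrodingerGraph V E R) : Type _ :=
  PiLp 2 (fun i : E ⊕ R => Lp ℂ 2 (volume.restrict (Γ.interval i)))

/-- `ψ` lies in the domain of the Schrödinger operator `L` of the graph, and `L ψ = φ`.
Here `ψ = u`, `u` is `C¹` up to the ends, `u'` is (locally) absolutely continuous with
`-u'' + q u = φ` (written in integrated form), and the vertex conditions hold. -/
def OperatorRel (Γ : SchrodingerGraph V E R) (ψ φ : Γ.HilbertSpace) : Prop :=
  ∃ u u' : E ⊕ R → ℝ → ℂ,
    (∀ i, (ψ i : ℝ → ℂ) =ᵐ[volume.restrict (Γ.interval i)] u i) ∧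
    (∀ i, ∀ x ∈ Γ.interval i, HasDerivWithinAt (u i) (u' i x) (Γ.interval i) x) ∧
    (∀ i, ∀ x ∈ Γ.interval i,
      u' i x = u' i 0 + ∫ t in (0 : ℝ)..x, ((Γ.q i t : ℂ) * u i t - (φ i : ℝ → ℂ) t)) ∧
    Γ.VertexConditions u u'

/-- `lam` is an eigenvalue of `L`, with an eigenvector in the Hilbert space. -/
def IsEigenvalue (Γ : SchrodingerGraph V E R) (lam : ℝ) : Prop :=
  ∃ ψ : Γ.HilbertSpace, ψ ≠ 0 ∧ Γ.OperatorRel ψ ((lam : ℂ) • ψ)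

/-- The (real) continuous spectrum of `L`: the `lam` for which the range of `L - lam` is not
closed. In this sense of the term it may contain eigenvalues. -/
def continuousSpectrum (Γ : SchrodingerGraph V E R) : Set ℝ :=
  {lam | ¬ IsClosed {χ : Γ.HilbertSpace |
    ∃ ψ φ : Γ.HilbertSpace, Γ.OperatorRel ψ φ ∧ φ - (lam : ℂ) • ψ = χ}}

/-- An eigenvalue embedded in the continuous spectrum. -/
def IsEmbeddedEigenvalue (Γ : SchrodingerGraph V E R) (lam : ℝ) : Prop :=
  Γ.IsEigenvalue lam ∧ lam ∈ Γ.continuousSpectrum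

/-! ### Splitting into stars -/

/-- The potentials on the rays obtained by cutting every interior edge `e` at the point `c e`:
each half carries, measured from its vertex, the potential of the edge up to the cut, and zero
beyond it. The rays of the graph keep their potential. -/
noncomputable def splitPotential (Γ : SchrodingerGraph V E R) (c : E → ℝ) :
    (E ⊕ E) ⊕ R → ℝ → ℝ
  | Sum.inl (Sum.inl e), x => if x ≤ c e then Γ.q (Sum.inl e) x else 0
  | Sum.inl (Sum.inr e), x =>
      if x ≤ Γ.len e - c e then Γ.q (Sum.inl e) (Γ.len e - x) else 0
  | Sum.inr r, x => Γ.q (Sum.inr r) x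

/-- The star at the vertex `v`: one vertex, no interior edges, one ray for every edge end
attached to `v`, and the boundary condition of `v`. -/
noncomputable def vertexStar (Γ : SchrodingerGraph V E R) (c : E → ℝ) (v : V) :
    SchrodingerGraph Unit Empty {h : (E ⊕ E) ⊕ R // Γ.vtx h = v} where
  len := Empty.elim
  len_pos := fun e => e.elim
  vtx := fun _ => ()
  q := Sum.elim Empty.elim (fun h => Γ.splitPotential c h.1)
  bc := fun w => (Γ.bc v).comap (LinearMap.funLeft ℂ (ℂ × ℂ)
    (fun h : {h : (E ⊕ E) ⊕ R // Γ.vtx h = v} =>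
      (⟨Sum.inr h, rfl⟩ :
        {_h : (Empty ⊕ Empty) ⊕ {h : (E ⊕ E) ⊕ R // Γ.vtx h = v} // () = w})))
  bc_lagrange := by
    intro w
    let e : {h : (E ⊕ E) ⊕ R // Γ.vtx h = v} ≃
        {_h : (Empty ⊕ Empty) ⊕ {h : (E ⊕ E) ⊕ R // Γ.vtx h = v} // () = w} :=
      { toFun := fun h => ⟨Sum.inr h, rfl⟩
        invFun := fun h => match h with
          | ⟨Sum.inr h, _⟩ => h
          | ⟨Sum.inl (Sum.inl x), _⟩ => x.elim
          | ⟨Sum.inl (Sum.inr x), _⟩ => x.elim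
        left_inv := fun h => rfl
        right_inv := by
          rintro ⟨(x | x) | h, hh⟩
          · exact x.elim
          · exact x.elim
          · rfl }
    have key : ∀ φ ψ, boundaryForm (fun h => φ (e h)) (fun h => ψ (e h)) =
        boundaryForm φ ψ := by
      intro φ ψ
      unfold boundaryForm
      exact Equiv.sum_comp e
        (fun h => star (φ h).1 * (ψ h).2 - star (φ h).2 * (ψ h).1)
    intro φ
    rw [Submodule.mem_comap]
    refine (Γ.bc_lagrange v _).trans ⟨fun H ψ hψ => ?_, fun H ψ hψ => ?_⟩
    · rw [← key]
      exact H _ hψ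
    · have hm : (fun h => ψ (e.symm h)) ∈ (Γ.bc v).comap (LinearMap.funLeft ℂ (ℂ × ℂ) e) := by
        rw [Submodule.mem_comap]
        have : LinearMap.funLeft ℂ (ℂ × ℂ) e (fun h => ψ (e.symm h)) = ψ := by
          funext h
          simp [LinearMap.funLeft_apply]
        rw [this]
        exact hψ
      have h2 := H _ hm
      rw [← key] at h2
      simp only [Equiv.symm_apply_apply] at h2
      exact h2

/-- The scattering matrix of the disjoint union of the stars, with the rays listed as the `2p`
linking rays `E ⊕ E` (the two halves of each edge) followed by the rays `R`. -/
def unionScatteringMatrix (Γ : SchrodingerGraph V E R)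
    (S : ∀ v : V, Matrix {h : (E ⊕ E) ⊕ R // Γ.vtx h = v} {h : (E ⊕ E) ⊕ R // Γ.vtx h = v} ℂ) :
    Matrix ((E ⊕ E) ⊕ R) ((E ⊕ E) ⊕ R) ℂ :=
  fun i j => if h : Γ.vtx j = Γ.vtx i then S (Γ.vtx i) ⟨i, rfl⟩ ⟨j, h⟩ else 0

/-- The matrix `T` describing how the rays are linked, with `ζ = exp (-i k a)` on an edge of
length `a`: it is the 'scattering matrix' of the Lagrange plane spanned by
`(ζ f₊,e' + f₋,e'') / 2`, `(ζ f₊,e'' + f₋,e') / 2` and `(f₊,r + f₋,r) / 2`, where `e'`, `e''` are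
the two halves of the edge `e`. -/
noncomputable def linkingMatrix [DecidableEq E] [DecidableEq R] (Γ : SchrodingerGraph V E R)
    (k : ℝ) : Matrix ((E ⊕ E) ⊕ R) ((E ⊕ E) ⊕ R) ℂ :=
  let ζ : Matrix E E ℂ :=
    Matrix.diagonal fun e => Complex.exp (-(Complex.I * k * Γ.len e))
  Matrix.fromBlocks (Matrix.fromBlocks 0 ζ ζ 0) 0 0 1

end SchrodingerGraph

/-- The matrix `g = W* diag(S, 1) W` which takes the canonical basis
`(f₊ + f₋) / 2`, `(f₊ - f₋) / (2 i)` to the canonical basis belonging to the matrix `S`, that is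
`(S f₊ + f₋) / 2`, `(S f₊ - f₋) / (2 i)`. -/
noncomputable def canonicalTransform {m : Type*} [DecidableEq m] (S : Matrix m m ℂ) :
    Matrix (m ⊕ m) (m ⊕ m) ℂ :=
  (1 / 2 : ℂ) • Matrix.fromBlocks (S + 1) (Complex.I • (S - 1)) (-(Complex.I • (S - 1))) (S + 1)

namespace SchrodingerGraph

/-- The matrix `B_(2p)`: in `h = g gₙ*`, which expresses the canonical basis of the scattering
waves of the stars through the canonical basis adapted to the linking, it is the block of the
first `2p` rows of the upper half and the first `2p` columns of the right half. -/
noncomputable def matrixB {V E R : Type*} [Fintype E] [Fintype R] [DecidableEq V] [DecidableEq E]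
    [DecidableEq R] (Γ : SchrodingerGraph V E R) (k : ℝ)
    (S : ∀ v : V, Matrix {h : (E ⊕ E) ⊕ R // Γ.vtx h = v} {h : (E ⊕ E) ⊕ R // Γ.vtx h = v} ℂ) :
    Matrix (E ⊕ E) (E ⊕ E) ℂ :=
  (canonicalTransform (Γ.unionScatteringMatrix S) *
      (canonicalTransform (Γ.linkingMatrix k)).conjTranspose).submatrix
    (fun i => Sum.inl (Sum.inl i)) (fun j => Sum.inr (Sum.inl j))

end SchrodingerGraph

/-! Fix $k\ne0$. For an integrable potential on a ray the Jost solution $f$ exists, and since $q$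
and $k$ are real, $f$ and $\bar f$ are the outgoing and incoming solutions, with constant Wronskian
$\bar f f'-\bar f'f=2ik$. Boundary data at a vertex can therefore be written as $\alpha f+\beta\bar
f$, and the boundary form becomes $2ik(\langle\alpha,\alpha'\rangle-\langle\beta,\beta'\rangle)$. A
Lagrange plane is then the graph of a norm-preserving map from incoming $\beta$ to outgoing
$\alpha=\beta S$. This is existence and uniqueness of the scattering matrix
(`IsLagrangePlane.existsUnique_isPlaneScattering`).

No nonzero combination of $f$ and $\bar f$ is square integrable
(`IsJostPair.eq_zero_of_sq_integrable`), so an eigenfunction at $k^2$ vanishes on every ray. On an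
interior edge a solution is fixed by the amplitudes $w$ of the incoming waves of its two halves;
matching at the cut makes the outgoing amplitude of one half $\zeta$ times the incoming amplitude of
the other. Hence $k^2$ is an eigenvalue iff some $w\ne0$ on the linking rays scatters to these
linked amplitudes and to $0$ on the original rays (`isEigenvalue_iff`).

Multiplying out gives $B_{(m)}=\frac i2(S_{(m)}T_{(m)}^{\star}-1)$. A left null vector $w$ of
$B_{(2p)}$ expresses the linking condition on the $2p$ linking rays only. The condition on the
original rays comes for free: scattering conserves $\sum|\cdot|^2$ and $|\zeta|=1$, so the linking
rays already carry away the whole incoming flux (`det_matrixB_eq_zero_iff`).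

For the continuous spectrum, let $b(x)=1/(1+x^2)$ on one ray. The source $b''f+2b'f'$ is an $L^2$
limit of elements of the range of $\mathcal L-k^2$, obtained from $(b(s\,\cdot)-b)f$ as $s\to0$. It
is not itself in the range: a preimage would have to be $-bf$ on that ray and $0$ on the others, and
its total flux through the rays would be $2ik\neq0$. So $k^2$ is always in the continuous spectrum,
and every eigenvalue $k^2$ is embedded. -/

/-! ### Tail integrals -/

section Tail

variable {G : Type*} [NormedAddCommGroup G] [NormedSpace ℝ G]

theorem integral_Ioi_eq_sub_intervalIntegral {g : ℝ → G} (hg : Integrable g) (x : ℝ) :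
    ∫ t in Set.Ioi x, g t = (∫ t in Set.Ioi (0 : ℝ), g t) - ∫ t in (0 : ℝ)..x, g t := by
  rw [← intervalIntegral.integral_Ioi_sub_Ioi' (hg.integrableOn) (hg.integrableOn)]
  abel

theorem continuous_integral_Ioi {g : ℝ → G} (hg : Integrable g) :
    Continuous fun x => ∫ t in Set.Ioi x, g t := by
  rw [funext (integral_Ioi_eq_sub_intervalIntegral hg)]
  exact continuous_const.sub
    (intervalIntegral.continuous_primitive (fun a b => hg.intervalIntegrable) 0)

theorem tendsto_integral_Ioi_atTop {g : ℝ → G} (hg : Integrable g) :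
    Tendsto (fun x => ∫ t in Set.Ioi x, g t) atTop (𝓝 0) := by
  rw [funext (integral_Ioi_eq_sub_intervalIntegral hg)]
  have := (intervalIntegral_tendsto_integral_Ioi (0 : ℝ) hg.integrableOn tendsto_id).const_sub
    (∫ t in Set.Ioi (0 : ℝ), g t)
  simpa using this

theorem hasDerivAt_integral_Ioi [CompleteSpace G] {g : ℝ → G} (hg : Integrable g) {x : ℝ}
    (hx : ContinuousAt g x) : HasDerivAt (fun x => ∫ t in Set.Ioi x, g t) (-g x) x := by
  rw [funext (integral_Ioi_eq_sub_intervalIntegral hg)]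
  exact (intervalIntegral.integral_hasDerivAt_right hg.intervalIntegrable
    (hg.aestronglyMeasurable.stronglyMeasurableAtFilter) hx).const_sub _

end Tail

/-! ### A linear Volterra equation with initial value at infinity -/

section Volterra

/-- An integrable function that is continuous off a finite set, against the exponential of its
tail integral. -/
theorem integral_Ioi_mul_exp_le {p : ℝ → ℝ} (hp : Integrable p) {F : Set ℝ}
    (hF : F.Finite) (hc : ∀ x ∉ F, ContinuousAt p x)
    (hi : Integrable fun t => p t * Real.exp (∫ s in Set.Ioi t, p s)) (x : ℝ) :
    ∫ t in Set.Ioi x, p t * Real.exp (∫ s in Set.Ioi t, p s) ≤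
      Real.exp (∫ s in Set.Ioi x, p s) := by
  refine le_of_tendsto (intervalIntegral_tendsto_integral_Ioi x hi.integrableOn tendsto_id) ?_
  filter_upwards [eventually_ge_atTop x] with b hb
  have := integral_eq_of_hasDerivAt_off_countable_of_le
    (fun t => -Real.exp (∫ s in Set.Ioi t, p s))
    (fun t => p t * Real.exp (∫ s in Set.Ioi t, p s)) hb hF.countable
    (Real.continuous_exp.comp (continuous_integral_Ioi hp)).neg.continuousOn
    (fun t ht => by
      have := ((hasDerivAt_integral_Ioi hp (hc t ht.2)).exp).fun_neg
      rwa [mul_neg, neg_neg, mul_comm] at this) hi.intervalIntegrable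
  rw [id, this]
  have := Real.exp_pos (∫ s in Set.Ioi b, p s)
  linarith

variable {G : Type*} [NormedAddCommGroup G] [NormedSpace ℝ G] [CompleteSpace G]

/-- The integral operator becomes a contraction in the sup norm weighted by `w = exp (2 ∫_x^∞ ‖M‖)`.
The weight lies between `1` and a constant, so boundedness of `y` is not affected. -/
theorem exists_volterra_solution {M : ℝ → G →L[ℝ] G} (hM : Integrable M) {F : Set ℝ}
    (hF : F.Finite) (hc : ∀ x ∉ F, ContinuousAt M x) (y₀ : G) :
    ∃ y : ℝ → G, Continuous y ∧ (∃ C, ∀ x, ‖y x‖ ≤ C) ∧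
      Integrable (fun t => M t (y t)) ∧ ∀ x, y x = y₀ - ∫ t in Set.Ioi x, M t (y t) := by
  -- The factor 2 produces the contraction ratio 1/2: `∫_x^∞ ‖M‖ w = (1/2) ∫_x^∞ p w ≤ w x / 2`.
  set p : ℝ → ℝ := fun t => 2 * ‖M t‖ with hp_def
  have hp : Integrable p := hM.norm.const_mul 2
  have hp0 : ∀ t, 0 ≤ p t := fun t => by positivity
  set P : ℝ → ℝ := fun x => ∫ s in Set.Ioi x, p s with hP_def
  have hP0 : ∀ x, 0 ≤ P x := fun x => setIntegral_nonneg measurableSet_Ioi fun t _ => hp0 t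
  have hPb : ∀ x, P x ≤ ∫ s, p s := fun x =>
    setIntegral_le_integral hp (ae_of_all _ hp0)
  have hPc : Continuous P := continuous_integral_Ioi hp
  set w : ℝ → ℝ := fun x => Real.exp (P x) with hw_def
  have hwc : Continuous w := Real.continuous_exp.comp hPc
  set C₀ : ℝ := Real.exp (∫ s, p s) with hC0
  have hwb : ∀ x, w x ≤ C₀ := fun x => Real.exp_le_exp.2 (hPb x)
  have hwpos : ∀ x, 0 < w x := fun x => Real.exp_pos _
  have hw1 : ∀ x, 1 ≤ w x := fun x => Real.one_le_exp (hP0 x)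
  have hmeas : ∀ z : ℝ → G, Continuous z → AEStronglyMeasurable (fun t => M t (z t)) :=
    fun z hz => (ContinuousLinearMap.id ℝ (G →L[ℝ] G)).aestronglyMeasurable_comp₂
      hM.aestronglyMeasurable hz.aestronglyMeasurable
  have hint : ∀ z : ℝ → G, Continuous z → (∃ C, ∀ x, ‖z x‖ ≤ C) →
      Integrable (fun t => M t (z t)) := by
    rintro z hz ⟨C, hC⟩
    refine (hM.norm.mul_const C).mono' (hmeas z hz) (ae_of_all _ fun t => ?_)
    exact ((M t).le_opNorm _).trans (mul_le_mul_of_nonneg_left (hC t) (norm_nonneg _))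
  have hpw : Integrable fun t => p t * w t := by
    refine (hp.mul_const C₀).mono' (hp.aestronglyMeasurable.mul hwc.aestronglyMeasurable)
      (ae_of_all _ fun t => ?_)
    rw [Real.norm_of_nonneg (mul_nonneg (hp0 t) (hwpos t).le)]
    exact mul_le_mul_of_nonneg_left (hwb t) (hp0 t)
  have hkey : ∀ x, ∫ t in Set.Ioi x, p t * w t ≤ w x := fun x =>
    integral_Ioi_mul_exp_le hp hF (fun x hx => ((hc x hx).norm).const_mul 2) hpw x
  have hzb : ∀ z : BoundedContinuousFunction ℝ G, ∃ C, ∀ x, ‖w x • z x‖ ≤ C := fun z =>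
    ⟨C₀ * ‖z‖, fun x => by
      rw [norm_smul, Real.norm_of_nonneg (hwpos x).le]
      exact mul_le_mul (hwb x) (z.norm_coe_le_norm x) (norm_nonneg _) (Real.exp_pos _).le⟩
  have hzc : ∀ z : BoundedContinuousFunction ℝ G, Continuous fun x => w x • z x := fun z =>
    hwc.smul z.continuous
  have hzi := fun z : BoundedContinuousFunction ℝ G => hint _ (hzc z) (hzb z)
  -- The unknown is `z = y / w`, so that the weighted norm of `y` is the ordinary sup norm of `z`.
  let Φ : BoundedContinuousFunction ℝ G → BoundedContinuousFunction ℝ G := fun z =>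
    BoundedContinuousFunction.ofNormedAddCommGroup
      (fun x => (w x)⁻¹ • (y₀ - ∫ t in Set.Ioi x, M t (w t • z t)))
      ((hwc.inv₀ fun x => (hwpos x).ne').smul
        (continuous_const.sub (continuous_integral_Ioi (hzi z))))
      (‖y₀‖ + ∫ t, ‖M t (w t • z t)‖) (fun x => by
        rw [norm_smul, norm_inv, Real.norm_of_nonneg (hwpos x).le]
        refine (mul_le_of_le_one_left (norm_nonneg _) (inv_le_one_of_one_le₀ (hw1 x))).trans ?_
        refine (norm_sub_le _ _).trans (add_le_add_right ?_ _)
        refine (norm_integral_le_integral_norm _).trans ?_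
        exact setIntegral_le_integral (hzi z).norm (ae_of_all _ fun t => norm_nonneg _))
  have hΦ : ContractingWith (1 / 2) Φ := by
    refine ⟨by rw [← NNReal.coe_lt_coe]; norm_num, LipschitzWith.of_dist_le_mul fun z z' => ?_⟩
    rw [BoundedContinuousFunction.dist_le (by positivity)]
    intro x
    have h1 : Φ z x - Φ z' x = -((w x)⁻¹ • ∫ t in Set.Ioi x, M t (w t • (z t - z' t))) := by
      change (w x)⁻¹ • (y₀ - ∫ t in Set.Ioi x, M t (w t • z t)) -
        (w x)⁻¹ • (y₀ - ∫ t in Set.Ioi x, M t (w t • z' t)) = _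
      have : ∀ t, M t (w t • (z t - z' t)) = M t (w t • z t) - M t (w t • z' t) := fun t => by
        rw [smul_sub, map_sub]
      simp_rw [this]
      rw [integral_sub (hzi z).integrableOn (hzi z').integrableOn, ← smul_sub, ← smul_neg]
      congr 1
      abel
    rw [dist_eq_norm, h1, norm_neg, norm_smul, norm_inv, Real.norm_of_nonneg (hwpos x).le]
    have h2 : ‖∫ t in Set.Ioi x, M t (w t • (z t - z' t))‖ ≤
        ∫ t in Set.Ioi x, (p t * w t) * (dist z z' / 2) := by
      refine norm_integral_le_of_norm_le (hpw.mul_const _).integrableOn (ae_of_all _ fun t => ?_)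
      refine ((M t).le_opNorm _).trans ?_
      rw [norm_smul, Real.norm_of_nonneg (hwpos t).le, ← dist_eq_norm]
      calc ‖M t‖ * (w t * dist (z t) (z' t)) ≤ ‖M t‖ * (w t * dist z z') := by
            gcongr
            exact BoundedContinuousFunction.dist_coe_le_dist t
        _ = _ := by simp only [hp_def]; ring
    rw [integral_mul_const] at h2
    have h3 : ‖∫ t in Set.Ioi x, M t (w t • (z t - z' t))‖ ≤ w x * (dist z z' / 2) :=
      h2.trans (mul_le_mul_of_nonneg_right (hkey x) (by positivity))
    calc _ ≤ (w x)⁻¹ * (w x * (dist z z' / 2)) :=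
          mul_le_mul_of_nonneg_left h3 (inv_nonneg.2 (hwpos x).le)
      _ = dist z z' / 2 := inv_mul_cancel_left₀ (hwpos x).ne' _
      _ = _ := by simp; ring
  obtain ⟨z, hz, -⟩ := hΦ.exists_fixedPoint (0 : BoundedContinuousFunction ℝ G)
    (edist_ne_top _ _)
  refine ⟨fun x => w x • z x, hzc z, hzb z, hzi z, fun x => ?_⟩
  have h1 : z x = (w x)⁻¹ • (y₀ - ∫ t in Set.Ioi x, M t (w t • z t)) :=
    (congrArg (fun g : BoundedContinuousFunction ℝ G => g x) hz).symm
  change w x • z x = _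
  conv_lhs => rw [h1, smul_inv_smul₀ (hwpos x).ne']

end Volterra

/-! ### Jost solutions -/

/-- A potential on a ray that is integrable, and continuous up to finitely many points. -/
def IsRayPotential (Q : ℝ → ℝ) : Prop :=
  IntegrableOn Q (Set.Ici 0) ∧
    ∃ F : Set ℝ, F.Finite ∧ ∀ x ∈ Set.Ici 0 \ F, ContinuousWithinAt Q (Set.Ici 0) x

/-- A Jost solution together with its derivative, and the properties that determine it. -/
structure IsJostPair (Q : ℝ → ℝ) (k : ℝ) (f f' : ℝ → ℂ) : Prop where
  sol : IsSolution Q (k ^ 2) (Set.Ici 0) f f'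
  tendsto : Tendsto (fun x : ℝ => f x * Complex.exp (-(Complex.I * k * x))) atTop (𝓝 1)
  tendsto' : Tendsto (fun x : ℝ => f' x * Complex.exp (-(Complex.I * k * x))) atTop
    (𝓝 (Complex.I * k))
  bdd : ∃ C, ∀ x, ‖f x‖ ≤ C ∧ ‖f' x‖ ≤ C
  free : ∀ d, 0 ≤ d → (∀ x, d < x → Q x = 0) → ∀ x, d ≤ x →
    f x = Complex.exp (Complex.I * k * x) ∧
      f' x = Complex.I * k * Complex.exp (Complex.I * k * x)

/-- `f` is the integral of the continuous function `g`, so the exceptional points disappear. This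
gives a Jost solution its first derivative also where the potential jumps. -/
theorem hasDerivAt_of_hasDerivAt_off_countable {f g : ℝ → ℂ} (hf : Continuous f)
    (hg : Continuous g) {F : Set ℝ} (hF : F.Countable) (h : ∀ x ∉ F, HasDerivAt f (g x) x)
    (x : ℝ) : HasDerivAt f (g x) x := by
  have h1 : ∀ x, f x = f 0 + ∫ t in (0 : ℝ)..x, g t := fun x => by
    rw [integral_eq_of_hasDerivAt_off_countable f g hF hf.continuousOn
      (fun t ht => h t ht.2) (hg.intervalIntegrable _ _)]
    ring
  rw [funext h1]
  exact (intervalIntegral.integral_hasDerivAt_right (hg.intervalIntegrable _ _)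
    (hg.stronglyMeasurableAtFilter _ _) hg.continuousAt).const_add _

theorem hasDerivAt_cexp_mul_I (c : ℂ) (x : ℝ) :
    HasDerivAt (fun x : ℝ => Complex.exp (c * x)) (c * Complex.exp (c * x)) x := by
  have h := ((Complex.ofRealCLM.hasDerivAt (x := x)).const_mul c).cexp
  simpa [mul_comm] using h

theorem norm_cexp_I_mul (k x : ℝ) : ‖Complex.exp (Complex.I * k * x)‖ = 1 := by
  have : Complex.I * k * x = ((k * x : ℝ) : ℂ) * Complex.I := by push_cast; ring
  rw [this, Complex.norm_exp_ofReal_mul_I]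

theorem norm_cexp_neg_I_mul (k x : ℝ) : ‖Complex.exp (-(Complex.I * k * x))‖ = 1 := by
  rw [Complex.exp_neg, norm_inv, norm_cexp_I_mul, inv_one]

theorem cexp_mul_cexp_neg (z : ℂ) : Complex.exp z * Complex.exp (-z) = 1 := by
  rw [← Complex.exp_add, add_neg_cancel, Complex.exp_zero]

/-! ### Variation of constants relative to the free waves. -/

section Interaction

/-- The coefficient matrix of the equation in the interaction picture. -/
noncomputable def interactionMatrix (k t : ℝ) : ℂ × ℂ →L[ℝ] ℂ × ℂ :=
  let c : ℂ := (2 * Complex.I * k)⁻¹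
  let i₁ := ContinuousLinearMap.inl ℝ ℂ ℂ
  let i₂ := ContinuousLinearMap.inr ℝ ℂ ℂ
  let p₁ := ContinuousLinearMap.fst ℝ ℂ ℂ
  let p₂ := ContinuousLinearMap.snd ℝ ℂ ℂ
  c • i₁.comp p₁ + (c * Complex.exp (-(2 * Complex.I * k) * t)) • i₁.comp p₂ -
    (c * Complex.exp (2 * Complex.I * k * t)) • i₂.comp p₁ - c • i₂.comp p₂

theorem interactionMatrix_apply (k t : ℝ) (y : ℂ × ℂ) :
    interactionMatrix k t y =
      ((2 * Complex.I * k)⁻¹ * (y.1 + Complex.exp (-(2 * Complex.I * k) * t) * y.2),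
        -((2 * Complex.I * k)⁻¹ * (Complex.exp (2 * Complex.I * k * t) * y.1 + y.2))) := by
  ext <;> simp [interactionMatrix] <;> ring

theorem continuous_interactionMatrix (k : ℝ) : Continuous (interactionMatrix k) := by
  unfold interactionMatrix
  fun_prop

theorem exists_norm_interactionMatrix_le (k : ℝ) : ∃ C, ∀ t, ‖interactionMatrix k t‖ ≤ C := by
  have h1 : ∀ t : ℝ, ‖Complex.exp (-(2 * Complex.I * k) * t)‖ = 1 := fun t => by
    have := norm_cexp_neg_I_mul (2 * k) t
    rw [← this]
    congr 2
    push_cast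
    ring
  have h2 : ∀ t : ℝ, ‖Complex.exp (2 * Complex.I * k * t)‖ = 1 := fun t => by
    have := norm_cexp_I_mul (2 * k) t
    rw [← this]
    congr 2
    push_cast
    ring
  refine ⟨‖(2 * Complex.I * k : ℂ)⁻¹‖ * 2, fun t =>
    ContinuousLinearMap.opNorm_le_bound _ (by positivity) fun y => ?_⟩
  have hy1 := norm_fst_le y
  have hy2 := norm_snd_le y
  rw [interactionMatrix_apply, Prod.norm_def, mul_assoc ‖_‖ 2]
  refine max_le ?_ ?_
  · rw [norm_mul]
    refine mul_le_mul_of_nonneg_left ((norm_add_le _ _).trans ?_) (norm_nonneg _)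
    rw [norm_mul, h1]
    linarith
  · rw [norm_neg, norm_mul]
    refine mul_le_mul_of_nonneg_left ((norm_add_le _ _).trans ?_) (norm_nonneg _)
    rw [norm_mul, h2]
    linarith

end Interaction

/-- Writing $f=Ae^{ikx}+Be^{-ikx}$ and $f'=ik(Ae^{ikx}-Be^{-ikx})$ turns the equation into
$(A,B)'=Q\,N\,(A,B)$ with a bounded matrix $N$. Since $k\ne0$, integrability of $Q$ alone makes the
Volterra equation from infinity solvable. -/
theorem exists_isJostPair {Q : ℝ → ℝ} (hQ : IsRayPotential Q) {k : ℝ} (hk : k ≠ 0) :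
    ∃ f f' : ℝ → ℂ, IsJostPair Q k f f' := by
  obtain ⟨hQi, F₀, hF₀, hQc⟩ := hQ
  -- The Volterra equation lives on all of `ℝ`; extending by zero may create a jump at `0`, which is
  -- added to the exceptional set.
  set Q₀ : ℝ → ℝ := (Set.Ici 0).indicator Q with hQ₀
  have hQ₀i : Integrable Q₀ := hQi.integrable_indicator measurableSet_Ici
  set F : Set ℝ := insert 0 F₀ with hFdef
  have hF : F.Finite := hF₀.insert 0
  have hQ₀c : ∀ x ∉ F, ContinuousAt Q₀ x := by
    intro x hx
    rw [hFdef, Set.mem_insert_iff, not_or] at hx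
    rcases lt_or_gt_of_ne hx.1 with h | h
    · refine (continuousAt_const (y := (0 : ℝ))).congr ?_
      filter_upwards [Iio_mem_nhds h] with y hy
      rw [hQ₀, Set.indicator_of_notMem]
      simpa using hy
    · have h1 : Set.Ici (0 : ℝ) ∈ 𝓝 x := Ici_mem_nhds h
      refine ((hQc x ⟨h.le, hx.2⟩).continuousAt h1).congr ?_
      filter_upwards [h1] with y hy
      rw [hQ₀, Set.indicator_of_mem hy]
  obtain ⟨C, hC⟩ := exists_norm_interactionMatrix_le k
  have hN := continuous_interactionMatrix k
  have hM : Integrable fun t => Q₀ t • interactionMatrix k t := by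
    refine (hQ₀i.norm.mul_const C).mono'
      (hQ₀i.aestronglyMeasurable.smul hN.aestronglyMeasurable) (ae_of_all _ fun t => ?_)
    rw [norm_smul]
    exact mul_le_mul_of_nonneg_left (hC t) (norm_nonneg _)
  -- The value `(1, 0)` at infinity means amplitude 1 for `exp (ikx)` and 0 for `exp (-ikx)`.
  obtain ⟨y, hyc, ⟨D, hD⟩, hyi, hy⟩ := exists_volterra_solution hM hF
    (fun x hx => (hQ₀c x hx).smul hN.continuousAt) ((1, 0) : ℂ × ℂ)
  have hyd : ∀ x ∉ F, HasDerivAt y ((Q₀ x • interactionMatrix k x) (y x)) x := by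
    intro x hx
    have h := (hasDerivAt_integral_Ioi hyi (x := x) (by
      have := ((hQ₀c x hx).smul (hN.continuousAt (x := x))).clm_apply hyc.continuousAt
      exact this)).const_sub (1, 0)
    rw [neg_neg, ← funext hy] at h
    exact h
  have hyt : Tendsto y atTop (𝓝 (1, 0)) := by
    have h := (tendsto_integral_Ioi_atTop hyi).const_sub (1, 0)
    rwa [sub_zero, ← funext hy] at h
  set c : ℂ := Complex.I * k with hc
  have hc0 : c ≠ 0 := mul_ne_zero Complex.I_ne_zero (Complex.ofReal_ne_zero.2 hk)
  have hcc : c * c = -(k : ℂ) ^ 2 := by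
    rw [hc]
    linear_combination (k : ℂ) ^ 2 * Complex.I_mul_I
  set f : ℝ → ℂ := fun x => (y x).1 * Complex.exp (c * x) + (y x).2 * Complex.exp (-c * x)
    with hf
  set f' : ℝ → ℂ := fun x =>
    c * ((y x).1 * Complex.exp (c * x) - (y x).2 * Complex.exp (-c * x)) with hf'
  have hfc : Continuous f := by fun_prop
  have hfc' : Continuous f' := by fun_prop
  have hd1 : ∀ x ∉ F, HasDerivAt (fun x => (y x).1)
      (Q₀ x * ((2 * c)⁻¹ * ((y x).1 + Complex.exp (-c * x) * Complex.exp (-c * x) * (y x).2)))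
        x := by
    intro x hx
    have h := (ContinuousLinearMap.fst ℝ ℂ ℂ).hasFDerivAt.comp_hasDerivAt x (hyd x hx)
    refine h.congr_deriv ?_
    simp only [_root_.smul_apply, interactionMatrix_apply, ContinuousLinearMap.coe_fst',
      Prod.smul_fst, Complex.real_smul]
    rw [← Complex.exp_add, hc]
    ring_nf
  have hd2 : ∀ x ∉ F, HasDerivAt (fun x => (y x).2)
      (-(Q₀ x * ((2 * c)⁻¹ * (Complex.exp (c * x) * Complex.exp (c * x) * (y x).1 + (y x).2))))
        x := by
    intro x hx
    have h := (ContinuousLinearMap.snd ℝ ℂ ℂ).hasFDerivAt.comp_hasDerivAt x (hyd x hx)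
    refine h.congr_deriv ?_
    simp only [_root_.smul_apply, interactionMatrix_apply, ContinuousLinearMap.coe_snd',
      Prod.smul_snd, Complex.real_smul]
    rw [← Complex.exp_add, hc]
    ring_nf
  have hee : ∀ x : ℝ, Complex.exp (c * x) * Complex.exp (-c * x) = 1 := fun x => by
    rw [← Complex.exp_add]
    ring_nf
    simp
  have hfd : ∀ x, HasDerivAt f (f' x) x := by
    refine hasDerivAt_of_hasDerivAt_off_countable hfc hfc' hF.countable fun x hx => ?_
    have h := ((hd1 x hx).mul (hasDerivAt_cexp_mul_I c x)).add
      ((hd2 x hx).mul (hasDerivAt_cexp_mul_I (-c) x))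
    refine HasDerivAt.congr_deriv (f := f) h ?_
    have := hee x
    change _ = c * _
    linear_combination -(Q₀ x : ℂ) * (2 * c)⁻¹ * ((y x).1 * Complex.exp (c * x) -
      (y x).2 * Complex.exp (-c * x)) * this
  have hfd' : ∀ x ∉ F, HasDerivAt f' ((Q₀ x - (k : ℂ) ^ 2) * f x) x := by
    intro x hx
    have h := (((hd1 x hx).mul (hasDerivAt_cexp_mul_I c x)).sub
      ((hd2 x hx).mul (hasDerivAt_cexp_mul_I (-c) x))).const_mul c
    refine HasDerivAt.congr_deriv (f := f') h ?_
    have := hee x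
    have h2 : c * (2 * c)⁻¹ = 1 / 2 := by field_simp
    change _ = (_ - _) * (_ + _)
    linear_combination (hcc + 2 * (Q₀ x : ℂ) * h2 + c * (2 * c)⁻¹ * (Q₀ x : ℂ) * this) *
      ((y x).1 * Complex.exp (c * x) + (y x).2 * Complex.exp (-c * x))
  have hB : Tendsto (fun x : ℝ => (y x).2 * (Complex.exp (-c * x) * Complex.exp (-c * x)))
      atTop (𝓝 0) := by
    have h0 : Tendsto (fun x => (y x).2) atTop (𝓝 0) := (continuous_snd.tendsto _).comp hyt
    refine squeeze_zero_norm (fun x => ?_) (by simpa using h0.norm)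
    rw [norm_mul, norm_mul, neg_mul, norm_cexp_neg_I_mul]
    simp
  have hA : Tendsto (fun x => (y x).1) atTop (𝓝 1) := (continuous_fst.tendsto _).comp hyt
  refine ⟨f, f', ⟨⟨fun x _ => (hfd x).hasDerivWithinAt, hfc'.continuousOn, F, hF, ?_⟩, ?_, ?_, ?_,
    ?_⟩⟩
  · intro x hx
    have := (hfd' x hx.2).hasDerivWithinAt (s := Set.Ici 0)
    rw [hQ₀, Set.indicator_of_mem hx.1] at this
    simpa using this
  · have := hA.add hB
    rw [add_zero] at this
    refine this.congr fun x => ?_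
    have hcx : -(Complex.I * k * x) = -c * x := by rw [hc]; ring
    rw [hcx]
    change _ = (_ + _) * _
    linear_combination -(y x).1 * hee x
  · have := (hA.sub hB).const_mul c
    rw [sub_zero, mul_one] at this
    refine this.congr fun x => ?_
    have hcx : -(Complex.I * k * x) = -c * x := by rw [hc]; ring
    rw [hcx]
    change _ = (c * _) * _
    linear_combination -c * (y x).1 * hee x
  · have h1 : ∀ x, ‖(y x).1 * Complex.exp (c * x)‖ ≤ D := fun x => by
      rw [norm_mul, norm_cexp_I_mul, mul_one]
      exact (norm_fst_le _).trans (hD x)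
    have h2 : ∀ x, ‖(y x).2 * Complex.exp (-c * x)‖ ≤ D := fun x => by
      rw [norm_mul, neg_mul, norm_cexp_neg_I_mul, mul_one]
      exact (norm_snd_le _).trans (hD x)
    refine ⟨max (D + D) (‖c‖ * (D + D)), fun x => ⟨?_, ?_⟩⟩
    · exact ((norm_add_le _ _).trans (add_le_add (h1 x) (h2 x))).trans (le_max_left _ _)
    · refine le_trans ?_ (le_max_right _ _)
      rw [hf', norm_mul]
      exact mul_le_mul_of_nonneg_left
        ((norm_sub_le _ _).trans (add_le_add (h1 x) (h2 x))) (norm_nonneg _)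
  -- Beyond the support of the potential the tail integral is zero, so the amplitudes are exactly
  -- `(1, 0)`. The point `x = d` is included because the integral runs over `t > x`; the matching at
  -- the cut relies on this.
  · intro d hd hQd x hx
    have h1 : y x = (1, 0) := by
      rw [hy, setIntegral_eq_zero_of_forall_eq_zero, sub_zero]
      intro t ht
      have ht' : d < t := lt_of_le_of_lt hx ht
      rw [hQ₀, Set.indicator_of_mem (show t ∈ Set.Ici 0 from hd.trans ht'.le), hQd t ht']
      simp
    simp [hf, hf', h1, hc]

theorem IsSolution.conj {q : ℝ → ℝ} {lam : ℝ} {s : Set ℝ} {f f' : ℝ → ℂ}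
    (h : IsSolution q lam s f f') :
    IsSolution q lam s (fun x => star (f x)) (fun x => star (f' x)) := by
  obtain ⟨h1, h2, F, hF, h3⟩ := h
  refine ⟨fun x hx => (h1 x hx).star, h2.star, F, hF, fun x hx => ?_⟩
  have := (h3 x hx).star
  simpa using this

/-- The potential and `k` are real, so $f_-=\overline{f_+}$ and a single Jost solution per ray
suffices. -/
theorem IsJostPair.conj {Q : ℝ → ℝ} {k : ℝ} {f f' : ℝ → ℂ} (h : IsJostPair Q k f f') :
    IsJostPair Q (-k) (fun x => star (f x)) (fun x => star (f' x)) where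
  sol := by
    rw [neg_sq]
    exact h.sol.conj
  tendsto := by
    have := h.tendsto.star
    simpa [← Complex.exp_conj] using this
  tendsto' := by
    have := h.tendsto'.star
    simpa [← Complex.exp_conj] using this
  bdd := by simpa using h.bdd
  free := fun d hd hQ x hx => by
    obtain ⟨h1, h2⟩ := h.free d hd hQ x hx
    simp [h1, h2, ← Complex.exp_conj]

/-! ### Wronskians -/

section Wronskian

variable {q : ℝ → ℝ} {lam : ℝ} {s : Set ℝ} {f f' g g' h h' : ℝ → ℂ}

theorem IsSolution.continuousOn (hf : IsSolution q lam s f f') : ContinuousOn f s :=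
  fun x hx => (hf.1 x hx).continuousWithinAt

theorem IsSolution.wronskian_eq (hf : IsSolution q lam s f f') (hg : IsSolution q lam s g g')
    (hs : s.OrdConnected) {x y : ℝ} (hx : x ∈ s) (hy : y ∈ s) :
    f x * g' x - f' x * g x = f y * g' y - f' y * g y := by
  wlog hxy : x ≤ y generalizing x y
  · exact (this hy hx (le_of_not_ge hxy)).symm
  have hsub : Set.Icc x y ⊆ s := hs.out hx hy
  obtain ⟨F, hF, hfF⟩ := hf.2.2
  obtain ⟨G, hG, hgG⟩ := hg.2.2
  have := integral_eq_of_hasDerivAt_off_countable_of_le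
    (fun t => f t * g' t - f' t * g t) (fun _ => 0) hxy (hF.union hG).countable
    (((hf.continuousOn.mul hg.2.1).sub (hf.2.1.mul hg.continuousOn)).mono hsub)
    (fun t ht => by
      have ht1 : s ∈ 𝓝 t := mem_of_superset (Icc_mem_nhds ht.1.1 ht.1.2) hsub
      have hts := mem_of_mem_nhds ht1
      have htF := ht.2
      rw [Set.mem_union, not_or] at htF
      have h1 := (hf.1 t hts).hasDerivAt ht1
      have h2 := (hg.1 t hts).hasDerivAt ht1
      have h3 := (hfF t ⟨hts, htF.1⟩).hasDerivAt ht1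
      have h4 := (hgG t ⟨hts, htF.2⟩).hasDerivAt ht1
      refine ((h1.mul h4).sub (h3.mul h2)).congr_deriv ?_
      ring) intervalIntegrable_const
  rw [intervalIntegral.integral_zero] at this
  exact (sub_eq_zero.1 this.symm).symm

theorem IsSolution.linearComb (hf : IsSolution q lam s f f') (hg : IsSolution q lam s g g')
    (a b : ℂ) :
    IsSolution q lam s (fun x => a * f x + b * g x) (fun x => a * f' x + b * g' x) := by
  obtain ⟨F, hF, hfF⟩ := hf.2.2
  obtain ⟨G, hG, hgG⟩ := hg.2.2
  refine ⟨fun x hx => ((hf.1 x hx).const_mul a).add ((hg.1 x hx).const_mul b),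
    (hf.2.1.const_mul a).add (hg.2.1.const_mul b), F ∪ G, hF.union hG, fun x hx => ?_⟩
  have hxF := hx.2
  rw [Set.mem_union, not_or] at hxF
  refine (((hfF x ⟨hx.1, hxF.1⟩).const_mul a).add
    ((hgG x ⟨hx.1, hxF.2⟩).const_mul b)).congr_deriv ?_
  ring

theorem IsSolution.mono {t : Set ℝ} (hf : IsSolution q lam s f f') (hts : t ⊆ s) :
    IsSolution q lam t f f' := by
  obtain ⟨h1, h2, F, hF, h3⟩ := hf
  exact ⟨fun x hx => (h1 x (hts hx)).mono hts, h2.mono hts, F, hF,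
    fun x hx => (h3 x ⟨hts hx.1, hx.2⟩).mono hts⟩

/-- Two solutions with nonzero Wronskian span the space of solutions. -/
theorem IsSolution.exists_eq_linearComb (hf : IsSolution q lam s f f')
    (hg : IsSolution q lam s g g') (hh : IsSolution q lam s h h') (hs : s.OrdConnected) {x₀ : ℝ}
    (hx₀ : x₀ ∈ s) (hW : f x₀ * g' x₀ - f' x₀ * g x₀ ≠ 0) :
    ∃ a b : ℂ, ∀ x ∈ s, h x = a * f x + b * g x ∧ h' x = a * f' x + b * g' x := by
  -- Cramer's rule; constancy of the three Wronskians makes the coefficients found at `x₀` valid at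
  -- every point.
  refine ⟨(h x₀ * g' x₀ - h' x₀ * g x₀) / (f x₀ * g' x₀ - f' x₀ * g x₀),
    (f x₀ * h' x₀ - f' x₀ * h x₀) / (f x₀ * g' x₀ - f' x₀ * g x₀), fun x hx => ?_⟩
  have h1 := hf.wronskian_eq hg hs hx₀ hx
  have h2 := hf.wronskian_eq hh hs hx₀ hx
  have h3 := hh.wronskian_eq hg hs hx₀ hx
  rw [h1] at hW
  rw [h1, h2, h3]
  constructor <;> rw [div_mul_eq_mul_div, div_mul_eq_mul_div, ← add_div, eq_div_iff hW] <;> ring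

theorem IsSolution.deriv_eqOn (hf : IsSolution q lam s f f') (hs : UniqueDiffOn ℝ s)
    (hg : ∀ x ∈ s, HasDerivWithinAt g (g' x) s x) (hfg : ∀ x ∈ s, f x = g x) :
    ∀ x ∈ s, f' x = g' x := fun x hx =>
  (hs x hx).eq_deriv _ (hf.1 x hx) ((hg x hx).congr (fun y hy => hfg y hy) (hfg x hx))

end Wronskian

/-! ### The solutions on a ray -/

section Ray

variable {Q : ℝ → ℝ} {k : ℝ} {f f' g g' : ℝ → ℂ}

theorem IsJostPair.isJost (hf : IsJostPair Q k f f') : IsJost Q k f :=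
  ⟨⟨f', hf.sol⟩, hf.tendsto⟩

/-- The Wronskian is constant and can be read off from the asymptotics at infinity. -/
theorem IsJostPair.wronskian (hf : IsJostPair Q k f f') {x : ℝ} (hx : 0 ≤ x) :
    star (f x) * f' x - star (f' x) * f x = 2 * Complex.I * k := by
  have h1 : Tendsto (fun x => star (f x) * f' x - star (f' x) * f x) atTop
      (𝓝 (1 * (Complex.I * k) - Complex.I * ((-k : ℝ) : ℂ) * 1)) := by
    refine ((hf.conj.tendsto.mul hf.tendsto').sub (hf.conj.tendsto'.mul hf.tendsto)).congr
      fun x => ?_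
    have := cexp_mul_cexp_neg (Complex.I * k * x)
    push_cast
    rw [show -(Complex.I * -(k : ℂ) * x) = Complex.I * k * x by ring]
    linear_combination (star (f x) * f' x - star (f' x) * f x) * this
  have h2 : Tendsto (fun x => star (f x) * f' x - star (f' x) * f x) atTop
      (𝓝 (star (f x) * f' x - star (f' x) * f x)) := by
    refine tendsto_const_nhds.congr' ?_
    filter_upwards [eventually_ge_atTop 0] with y hy
    exact hf.sol.conj.wronskian_eq hf.sol Set.ordConnected_Ici hx hy
  rw [tendsto_nhds_unique h2 h1]
  push_cast
  ring

theorem IsJostPair.exists_eq (hf : IsJostPair Q k f f') (hk : k ≠ 0)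
    (hg : IsSolution Q (k ^ 2) (Set.Ici 0) g g') :
    ∃ a b : ℂ, ∀ x, 0 ≤ x →
      g x = a * f x + b * star (f x) ∧ g' x = a * f' x + b * star (f' x) := by
  refine hf.sol.exists_eq_linearComb hf.sol.conj hg Set.ordConnected_Ici
    (Set.mem_Ici.2 le_rfl) fun h => ?_
  have h1 := hf.wronskian (le_refl (0 : ℝ))
  have h2 : (2 * Complex.I * k : ℂ) = 0 := by
    rw [← h1]
    linear_combination -h
  simp [hk] at h2

/-- The shift is half a period of `exp (2ikx)`, whose sign it reverses. Comparing a function with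
its shift removes the oscillating interference between outgoing and incoming waves. -/
theorem cexp_half_period {k : ℝ} (hk : k ≠ 0) (x : ℝ) :
    Complex.exp (Complex.I * k * ((x + Real.pi / (2 * k) : ℝ) : ℂ)) =
      Complex.I * Complex.exp (Complex.I * k * x) := by
  have : Complex.I * k * ((x + Real.pi / (2 * k) : ℝ) : ℂ) =
      Real.pi / 2 * Complex.I + Complex.I * k * x := by
    have : (k : ℂ) ≠ 0 := Complex.ofReal_ne_zero.2 hk
    push_cast
    field_simp
    ring
  rw [this, Complex.exp_add, Complex.exp_pi_div_two_mul_I]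

/-- A combination of the Jost solutions that tends to a limit after multiplication by
`exp (-ikx)` is a multiple of the first one. -/
theorem IsJostPair.eq_of_tendsto (hf : IsJostPair Q k f f') (hk : k ≠ 0) {a b l : ℂ}
    (h : Tendsto (fun x : ℝ => (a * f x + b * star (f x)) * Complex.exp (-(Complex.I * k * x)))
      atTop (𝓝 l)) : a = l ∧ b = 0 := by
  have h1 : Tendsto (fun x : ℝ => b * Complex.exp (-(Complex.I * k * x)) ^ 2) atTop
      (𝓝 (l - a)) := by
    have h2 : Tendsto (fun x : ℝ => star (f x) * Complex.exp (-(Complex.I * k * x)) -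
        Complex.exp (-(Complex.I * k * x)) ^ 2) atTop (𝓝 0) := by
      have h3 : Tendsto (fun x : ℝ => star (f x) * Complex.exp (Complex.I * k * x) - 1) atTop
          (𝓝 0) := by
        have := hf.conj.tendsto.sub_const 1
        rw [sub_self] at this
        refine this.congr fun x => ?_
        push_cast
        rw [show -(Complex.I * -(k : ℂ) * x) = Complex.I * k * x by ring]
      refine squeeze_zero_norm (a := fun x => ‖star (f x) * Complex.exp (Complex.I * k * x) - 1‖)
        (fun x => ?_) (by simpa using h3.norm)
      have : star (f x) * Complex.exp (-(Complex.I * k * x)) -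
          Complex.exp (-(Complex.I * k * x)) ^ 2 =
          (star (f x) * Complex.exp (Complex.I * k * x) - 1) *
            (Complex.exp (-(Complex.I * k * x)) * Complex.exp (-(Complex.I * k * x))) := by
        linear_combination -(star (f x) * Complex.exp (-(Complex.I * k * x))) *
          cexp_mul_cexp_neg (Complex.I * k * x)
      rw [this, norm_mul, norm_mul, norm_cexp_neg_I_mul]
      simp
    have h4 := (h.sub (hf.tendsto.const_mul a)).sub (h2.const_mul b)
    rw [mul_one, mul_zero, sub_zero] at h4
    refine h4.congr fun x => ?_
    ring
  -- The shifted function is the negative of the original, so the limit `l - a` equals its own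
  -- negative. As the modulus is constantly `‖b‖`, also `b = 0`.
  have h5 := h1.comp (tendsto_atTop_add_const_right atTop (Real.pi / (2 * k)) tendsto_id)
  have h6 : Tendsto (fun x : ℝ => b * Complex.exp (-(Complex.I * k * x)) ^ 2) atTop
      (𝓝 (-(l - a))) := by
    refine h5.neg.congr fun x => ?_
    simp only [Function.comp, id]
    rw [Complex.exp_neg, cexp_half_period hk, Complex.exp_neg, mul_inv, mul_pow, inv_pow,
      Complex.I_sq]
    ring
  have h7 : l - a = 0 := by
    have := tendsto_nhds_unique h1 h6
    linear_combination this / 2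
  refine ⟨(sub_eq_zero.1 h7).symm, ?_⟩
  have h8 := h1.norm
  simp only [norm_mul, norm_pow, norm_cexp_neg_I_mul, h7, norm_zero, one_pow, mul_one] at h8
  exact norm_eq_zero.1 (tendsto_nhds_unique tendsto_const_nhds h8)

/-- `IsScatteringMatrix` allows any Jost solutions; this uniqueness lets them be replaced by `f` and
its conjugate. -/
theorem IsJostPair.eqOn_of_isJost (hf : IsJostPair Q k f f') (hk : k ≠ 0) (hg : IsJost Q k g) :
    ∀ x, 0 ≤ x → g x = f x := by
  obtain ⟨⟨g', hg'⟩, hgt⟩ := hg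
  obtain ⟨a, b, hab⟩ := hf.exists_eq hk hg'
  have h1 : Tendsto (fun x : ℝ => (a * f x + b * star (f x)) *
      Complex.exp (-(Complex.I * k * x))) atTop (𝓝 1) := by
    refine hgt.congr' ?_
    filter_upwards [eventually_ge_atTop 0] with x hx
    rw [(hab x hx).1]
  obtain ⟨rfl, rfl⟩ := hf.eq_of_tendsto hk h1
  intro x hx
  rw [(hab x hx).1]
  ring

theorem norm_sq_mul_add_mul_star (a b z : ℂ) :
    ‖a * z + b * star z‖ ^ 2 =
      (‖a‖ ^ 2 + ‖b‖ ^ 2) * ‖z‖ ^ 2 + 2 * (a * star b * z ^ 2).re := by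
  have : a * z * (starRingEnd ℂ) (b * star z) = a * star b * z ^ 2 := by
    rw [map_mul, starRingEnd_apply, starRingEnd_apply, star_star]
    ring
  rw [Complex.sq_norm, Complex.normSq_add, this]
  simp only [Complex.sq_norm, Complex.normSq_mul]
  simp only [Complex.star_def, Complex.normSq_conj]
  ring

/-- No nonzero combination of the Jost solutions is square integrable. -/
theorem IsJostPair.eq_zero_of_sq_integrable (hf : IsJostPair Q k f f') (hk : k ≠ 0) {a b : ℂ}
    (h : IntegrableOn (fun x => ‖a * f x + b * star (f x)‖ ^ 2) (Set.Ici 0)) :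
    a = 0 ∧ b = 0 := by
  set T : ℝ := Real.pi / (2 * k) with hT
  set e : ℝ → ℂ := fun x => Complex.exp (Complex.I * k * x) with he
  set u : ℝ → ℂ := fun x => f x * Complex.exp (-(Complex.I * k * x)) with hu
  have hfu : ∀ x, f x = u x * e x := fun x => by
    simp only [hu, he]
    linear_combination -f x * cexp_mul_cexp_neg (Complex.I * k * x)
  have hen : ∀ x, ‖e x‖ = 1 := fun x => norm_cexp_I_mul k x
  have heT : ∀ x, e (x + T) = Complex.I * e x := cexp_half_period hk
  have hut : Tendsto u atTop (𝓝 1) := hf.tendsto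
  have hshift : Tendsto (fun x : ℝ => x + T) atTop atTop :=
    tendsto_atTop_add_const_right atTop T tendsto_id
  have hutT := hut.comp hshift
  -- In the sum of `‖a f + b conj f‖ ^ 2` at `x` and `x + T` the cross terms cancel in the limit,
  -- leaving `2 (‖a‖ ^ 2 + ‖b‖ ^ 2)`. An integrable function can only have the limit `0`.
  have h1 : Tendsto (fun x => f x ^ 2 + f (x + T) ^ 2) atTop (𝓝 0) := by
    have h2 : Tendsto (fun x => u x ^ 2 - u (x + T) ^ 2) atTop (𝓝 0) := by
      simpa using (hut.pow 2).sub (hutT.pow 2)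
    refine squeeze_zero_norm (fun x => ?_) (by simpa using h2.norm)
    have : f x ^ 2 + f (x + T) ^ 2 = e x ^ 2 * (u x ^ 2 - u (x + T) ^ 2) := by
      rw [hfu, hfu, heT]
      linear_combination (u (x + T) * e x) ^ 2 * Complex.I_sq
    rw [this, norm_mul, norm_pow, hen, one_pow, one_mul]
  have h2 : Tendsto (fun x => ‖f x‖ ^ 2 + ‖f (x + T)‖ ^ 2) atTop (𝓝 2) := by
    have h3 := (hut.norm.pow 2).add (hutT.norm.pow 2)
    simp only [norm_one] at h3
    norm_num at h3
    refine h3.congr fun x => ?_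
    rw [hfu, hfu, norm_mul (u x), norm_mul (u (x + T)), hen, hen, mul_one, mul_one]
  have h3 : Tendsto (fun x => ‖a * f x + b * star (f x)‖ ^ 2 +
      ‖a * f (x + T) + b * star (f (x + T))‖ ^ 2) atTop
      (𝓝 ((‖a‖ ^ 2 + ‖b‖ ^ 2) * 2 + 2 * (a * star b * 0).re)) := by
    refine ((h2.const_mul (‖a‖ ^ 2 + ‖b‖ ^ 2)).add (((Complex.continuous_re.tendsto _).comp
      (h1.const_mul (a * star b))).const_mul 2)).congr fun x => ?_
    rw [norm_sq_mul_add_mul_star, norm_sq_mul_add_mul_star]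
    simp only [Function.comp, mul_add, Complex.add_re]
    ring
  have h4 : IntegrableAtFilter (fun x => ‖a * f x + b * star (f x)‖ ^ 2 +
      ‖a * f (x + T) + b * star (f (x + T))‖ ^ 2) atTop := by
    -- `T` is negative when `k` is, so `x ≥ -T` is needed to keep `x + T` on the ray.
    refine ⟨Set.Ici 0 ∩ Set.Ici (-T), inter_mem (Ici_mem_atTop _) (Ici_mem_atTop _), ?_⟩
    refine (h.mono_set Set.inter_subset_left).add ?_
    have h5 := ((measurePreserving_add_right volume T).integrableOn_comp_preimage
      (measurableEmbedding_addRight T)).2 h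
    refine h5.mono_set fun x hx => ?_
    have := hx.2
    simp only [Set.mem_Ici, Set.mem_preimage] at this ⊢
    linarith
  have h5 := h4.eq_zero_of_tendsto (fun s hs => by
    obtain ⟨c, hc⟩ := mem_atTop_sets.1 hs
    exact measure_mono_top (s₁ := Set.Ici c) (fun x hx => hc x hx) Real.volume_Ici) h3
  simp only [mul_zero, Complex.zero_re, add_zero] at h5
  have ha := sq_nonneg ‖a‖
  have hb := sq_nonneg ‖b‖
  constructor
  · exact norm_eq_zero.1 (pow_eq_zero_iff two_ne_zero |>.1 (by linarith))
  · exact norm_eq_zero.1 (pow_eq_zero_iff two_ne_zero |>.1 (by linarith))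

end Ray

/-! ### Lagrange planes and scattering matrices -/

section Lagrange

variable {ι : Type*}

/-- The boundary data of `α f + β conj f`, where `f` has the boundary data `(a, b)`. -/
noncomputable def jostData (a b : ι → ℂ) :
    (ι → ℂ) × (ι → ℂ) →ₗ[ℂ] (ι → ℂ × ℂ) where
  toFun p h := (p.1 h * a h + p.2 h * star (a h), p.1 h * b h + p.2 h * star (b h))
  map_add' p p' := by
    funext h
    simp only [Prod.fst_add, Prod.snd_add, Pi.add_apply, Prod.mk_add_mk]
    ext <;> ring
  map_smul' c p := by
    funext h
    simp only [Prod.smul_fst, Prod.smul_snd, Pi.smul_apply, smul_eq_mul, RingHom.id_apply,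
      Prod.smul_mk]
    ext <;> ring

variable {a b : ι → ℂ}

theorem jostData_apply (α β : ι → ℂ) (h : ι) :
    jostData a b (α, β) h =
      (α h * a h + β h * star (a h), α h * b h + β h * star (b h)) := rfl

variable {k : ℝ}

theorem exists_eq_jostData (hk : k ≠ 0)
    (hW : ∀ h, star (a h) * b h - star (b h) * a h = 2 * Complex.I * k) (φ : ι → ℂ × ℂ) :
    ∃ α β, φ = jostData a b (α, β) := by
  have h0 : (2 * Complex.I * k : ℂ) ≠ 0 := by simp [hk]
  refine ⟨fun h => (star (a h) * (φ h).2 - star (b h) * (φ h).1) / (2 * Complex.I * k),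
    fun h => (b h * (φ h).1 - a h * (φ h).2) / (2 * Complex.I * k), ?_⟩
  funext h
  rw [jostData_apply]
  ext
  · simp only
    rw [div_mul_eq_mul_div, div_mul_eq_mul_div, ← add_div, eq_div_iff h0]
    linear_combination -(φ h).1 * hW h
  · simp only
    rw [div_mul_eq_mul_div, div_mul_eq_mul_div, ← add_div, eq_div_iff h0]
    linear_combination -(φ h).2 * hW h

variable [Fintype ι]

/-- Jost coordinates diagonalise the form, with outgoing amplitudes counted positively and incoming
ones negatively. -/
theorem boundaryForm_jostData (hW : ∀ h, star (a h) * b h - star (b h) * a h = 2 * Complex.I * k)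
    (α β α' β' : ι → ℂ) :
    boundaryForm (jostData a b (α, β)) (jostData a b (α', β')) =
      2 * Complex.I * k * ∑ h, (star (α h) * α' h - star (β h) * β' h) := by
  unfold boundaryForm
  rw [Finset.mul_sum]
  refine Finset.sum_congr rfl fun h _ => ?_
  simp only [jostData_apply, star_add, star_mul', star_star]
  linear_combination (star (α h) * α' h - star (β h) * β' h) * hW h

variable {P : Submodule ℂ (ι → ℂ × ℂ)}

/-- Conservation of flux. -/
theorem sum_norm_sq_eq_of_boundaryForm_eq_zero (hk : k ≠ 0)
    (hW : ∀ h, star (a h) * b h - star (b h) * a h = 2 * Complex.I * k) {α β : ι → ℂ}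
    (h1 : boundaryForm (jostData a b (α, β)) (jostData a b (α, β)) = 0) :
    ∑ i, ‖α i‖ ^ 2 = ∑ i, ‖β i‖ ^ 2 := by
  have h0 : (2 * Complex.I * k : ℂ) ≠ 0 := by simp [hk]
  rw [boundaryForm_jostData hW] at h1
  have h2 := (mul_eq_zero.1 h1).resolve_left h0
  rw [Finset.sum_sub_distrib, sub_eq_zero] at h2
  have h3 : ∀ z : ℂ, star z * z = ((‖z‖ ^ 2 : ℝ) : ℂ) := fun z => by
    rw [mul_comm, Complex.star_def, Complex.mul_conj, Complex.normSq_eq_norm_sq]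
  simp only [h3] at h2
  exact_mod_cast h2

theorem IsLagrangePlane.sum_norm_sq_eq (hP : IsLagrangePlane P) (hk : k ≠ 0)
    (hW : ∀ h, star (a h) * b h - star (b h) * a h = 2 * Complex.I * k) {α β : ι → ℂ}
    (h : jostData a b (α, β) ∈ P) : ∑ i, ‖α i‖ ^ 2 = ∑ i, ‖β i‖ ^ 2 :=
  sum_norm_sq_eq_of_boundaryForm_eq_zero hk hW ((hP _).1 h _ h)

theorem IsLagrangePlane.eq_zero_of_jostData_mem (hP : IsLagrangePlane P) (hk : k ≠ 0)
    (hW : ∀ h, star (a h) * b h - star (b h) * a h = 2 * Complex.I * k) {α : ι → ℂ}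
    (h : jostData a b (α, 0) ∈ P) : α = 0 := by
  have h1 := hP.sum_norm_sq_eq hk hW h
  simp only [Pi.zero_apply, norm_zero, ne_eq, OfNat.ofNat_ne_zero, not_false_eq_true, zero_pow,
    Finset.sum_const_zero] at h1
  rw [Finset.sum_eq_zero_iff_of_nonneg fun i _ => sq_nonneg _] at h1
  funext i
  simpa using h1 i (Finset.mem_univ i)

/-- If the incoming parts of `P` did not fill the space, some `β₀ ≠ 0` would be orthogonal to them
all. Then `(0, β₀)` is form-orthogonal to `P`, hence in `P` by maximality, and conservation of flux
forces `β₀ = 0`. -/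
theorem IsLagrangePlane.exists_jostData_mem [DecidableEq ι] (hP : IsLagrangePlane P) (hk : k ≠ 0)
    (hW : ∀ h, star (a h) * b h - star (b h) * a h = 2 * Complex.I * k) (β : ι → ℂ) :
    ∃ α, jostData a b (α, β) ∈ P := by
  set N : Submodule ℂ (ι → ℂ) := (P.comap (jostData a b)).map (LinearMap.snd ℂ _ _) with hN
  suffices N = ⊤ by
    have h1 : β ∈ N := this ▸ Submodule.mem_top
    obtain ⟨⟨α, β'⟩, h2, rfl⟩ := Submodule.mem_map.1 h1
    exact ⟨α, h2⟩
  by_contra hne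
  obtain ⟨l, hl, hNl⟩ := Submodule.exists_le_ker_of_lt_top N (lt_top_iff_ne_top.2 hne)
  set β₀ : ι → ℂ := fun i => star (l (Pi.single i 1)) with hβ₀
  have hlsum : ∀ β, l β = ∑ i, star (β₀ i) * β i := fun β => by
    conv_lhs => rw [pi_eq_sum_univ' β]
    simp only [map_sum, map_smul, smul_eq_mul, hβ₀, star_star]
    refine Finset.sum_congr rfl fun i _ => ?_
    rw [mul_comm]
  have h1 : jostData a b (0, β₀) ∈ P := by
    rw [hP]
    intro ψ hψ
    obtain ⟨α, β, rfl⟩ := exists_eq_jostData hk hW ψ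
    have h2 : β ∈ N := Submodule.mem_map.2 ⟨(α, β), hψ, rfl⟩
    have h3 : l β = 0 := hNl h2
    rw [boundaryForm_jostData hW]
    simp only [Pi.zero_apply, star_zero, zero_mul, zero_sub, Finset.sum_neg_distrib]
    rw [← hlsum, h3]
    simp
  have h2 := hP.sum_norm_sq_eq hk hW h1
  simp only [Pi.zero_apply, norm_zero, ne_eq, OfNat.ofNat_ne_zero, not_false_eq_true, zero_pow,
    Finset.sum_const_zero] at h2
  rw [eq_comm, Finset.sum_eq_zero_iff_of_nonneg fun i _ => sq_nonneg _] at h2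
  refine hl (LinearMap.ext fun β => ?_)
  rw [hlsum]
  refine Finset.sum_eq_zero fun i hi => ?_
  have h3 : β₀ i = 0 := by simpa using h2 i hi
  simp [h3]

variable [DecidableEq ι]

/-- The rows of `S` describe waves satisfying the boundary condition `P`. -/
def IsPlaneScattering (P : Submodule ℂ (ι → ℂ × ℂ)) (a b : ι → ℂ) (S : Matrix ι ι ℂ) : Prop :=
  ∀ i, jostData a b (S i, Pi.single i 1) ∈ P

/-- `P` is the graph of `β ↦ β S`: two elements with the same incoming part differ by a purely
outgoing one, which is zero. The first index of `S` is the incoming ray, whence row vectors. -/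
theorem IsPlaneScattering.jostData_mem_iff (hP : IsLagrangePlane P) (hk : k ≠ 0)
    (hW : ∀ h, star (a h) * b h - star (b h) * a h = 2 * Complex.I * k) {S : Matrix ι ι ℂ}
    (hS : IsPlaneScattering P a b S) (α β : ι → ℂ) :
    jostData a b (α, β) ∈ P ↔ α = Matrix.vecMul β S := by
  have h1 : jostData a b (Matrix.vecMul β S, β) ∈ P := by
    have : (Matrix.vecMul β S, β) = ∑ i, β i • ((S i, Pi.single i 1) : (ι → ℂ) × (ι → ℂ)) := by
      ext j
      · simp [Matrix.vecMul, dotProduct, Prod.fst_sum]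
      · simp [Prod.snd_sum, Pi.single_apply]
    rw [this, map_sum]
    refine Submodule.sum_mem _ fun i _ => ?_
    rw [map_smul]
    exact P.smul_mem _ (hS i)
  refine ⟨fun h => ?_, fun h => h ▸ h1⟩
  have h2 := P.sub_mem h h1
  rw [← map_sub, Prod.mk_sub_mk, sub_self] at h2
  exact sub_eq_zero.1 (hP.eq_zero_of_jostData_mem hk hW h2)

theorem IsLagrangePlane.existsUnique_isPlaneScattering (hP : IsLagrangePlane P) (hk : k ≠ 0)
    (hW : ∀ h, star (a h) * b h - star (b h) * a h = 2 * Complex.I * k) :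
    ∃! S, IsPlaneScattering P a b S := by
  choose S hS using fun i => hP.exists_jostData_mem hk hW (Pi.single i (1 : ℂ))
  refine ⟨S, hS, fun S' hS' => ?_⟩
  funext i
  have h1 := (IsPlaneScattering.jostData_mem_iff hP hk hW (S := S) hS _ _).1 (hS' i)
  rw [h1]
  have h2 := (IsPlaneScattering.jostData_mem_iff hP hk hW (S := S) hS _ _).1 (hS i)
  exact h2.symm

end Lagrange

/-! ### The stars -/

namespace SchrodingerGraph

section Star

variable {V E R : Type*} [Fintype E] [Fintype R] [DecidableEq V]

theorem isRayPotential_truncate {p : ℝ → ℝ} {d : ℝ} (hp : ContinuousOn p (Set.Icc 0 d)) :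
    IsRayPotential fun x => if x ≤ d then p x else 0 := by
  constructor
  · have h1 : IntegrableOn ((Set.Icc 0 d).indicator p) (Set.Ici 0) :=
      ((integrable_indicator_iff measurableSet_Icc).2 hp.integrableOn_Icc).integrableOn
    refine h1.congr_fun (fun x hx => ?_) measurableSet_Ici
    simp only [Set.indicator_apply, Set.mem_Icc, Set.mem_Ici.1 hx, true_and]
  · refine ⟨{d}, Set.finite_singleton d, fun x hx => ?_⟩
    rcases lt_or_gt_of_ne (show x ≠ d from hx.2) with h | h
    · have h1 : ContinuousWithinAt p (Set.Ici 0) x := by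
        refine (hp x ⟨hx.1, h.le⟩).mono_of_mem_nhdsWithin ?_
        have : Set.Iic d ∈ 𝓝[Set.Ici 0] x := mem_nhdsWithin_of_mem_nhds (Iic_mem_nhds h)
        filter_upwards [this, self_mem_nhdsWithin] with y hy hy' using ⟨hy', hy⟩
      refine h1.congr_of_eventuallyEq ?_ (if_pos h.le)
      have : Set.Iic d ∈ 𝓝[Set.Ici 0] x := mem_nhdsWithin_of_mem_nhds (Iic_mem_nhds h)
      filter_upwards [this] with y hy using if_pos hy
    · refine (continuousWithinAt_const (b := (0 : ℝ))).congr_of_eventuallyEq ?_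
        (if_neg (not_le.2 h))
      have : Set.Ioi d ∈ 𝓝[Set.Ici 0] x := mem_nhdsWithin_of_mem_nhds (Ioi_mem_nhds h)
      filter_upwards [this] with y hy using if_neg (not_le.2 hy)

theorem RegularPotentials.integrableOn_ray {Γ : SchrodingerGraph V E R}
    (hΓ : Γ.RegularPotentials) (r : R) : IntegrableOn (Γ.q (Sum.inr r)) (Set.Ici 0) := by
  refine (hΓ.2 r).mono' ((hΓ.1 (Sum.inr r)).aestronglyMeasurable measurableSet_Ici) ?_
  filter_upwards [ae_restrict_mem measurableSet_Ici] with x hx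
  rw [Real.norm_eq_abs]
  have : (0 : ℝ) ≤ x := hx
  nlinarith [abs_nonneg (Γ.q (Sum.inr r) x)]

theorem RegularPotentials.isRayPotential {Γ : SchrodingerGraph V E R}
    (hΓ : Γ.RegularPotentials) {c : E → ℝ} (hc : ∀ e, c e ∈ Set.Icc 0 (Γ.len e))
    (h : (E ⊕ E) ⊕ R) : IsRayPotential (Γ.splitPotential c h) := by
  rcases h with (e | e) | r
  · exact isRayPotential_truncate ((hΓ.1 (Sum.inl e)).mono (Set.Icc_subset_Icc_right (hc e).2))
  · refine isRayPotential_truncate (p := fun x => Γ.q (Sum.inl e) (Γ.len e - x)) ?_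
    refine (hΓ.1 (Sum.inl e)).comp (by fun_prop) fun x hx => ?_
    have h1 := (hc e).1
    have h2 := hx.1
    have h3 := hx.2
    exact ⟨by linarith, by linarith⟩
  · exact ⟨hΓ.integrableOn_ray r, ∅, Set.finite_empty, fun x hx => hΓ.1 (Sum.inr r) x hx.1⟩

/-- Jost solutions, with their derivatives, on the rays of all the stars. -/
def IsJostFamily (Γ : SchrodingerGraph V E R) (c : E → ℝ) (k : ℝ)
    (f f' : (E ⊕ E) ⊕ R → ℝ → ℂ) : Prop :=
  ∀ h, IsJostPair (Γ.splitPotential c h) k (f h) (f' h)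

theorem RegularPotentials.exists_isJostFamily {Γ : SchrodingerGraph V E R}
    (hΓ : Γ.RegularPotentials) {c : E → ℝ} (hc : ∀ e, c e ∈ Set.Icc 0 (Γ.len e)) {k : ℝ}
    (hk : k ≠ 0) : ∃ f f', Γ.IsJostFamily c k f f' := by
  choose f f' hf using fun h => exists_isJostPair (hΓ.isRayPotential hc h) hk
  exact ⟨f, f', hf⟩

theorem IsJostFamily.wronskian_zero {Γ : SchrodingerGraph V E R} {c : E → ℝ} {k : ℝ}
    {f f' : (E ⊕ E) ⊕ R → ℝ → ℂ} (hf : Γ.IsJostFamily c k f f') (h : (E ⊕ E) ⊕ R) :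
    star (f h 0) * f' h 0 - star (f' h 0) * f h 0 = 2 * Complex.I * k :=
  (hf h).wronskian le_rfl

/-- A star has no interior edges, so after fixing the Jost solutions only the condition on the data
at the vertex remains, which is linear algebra. -/
theorem isScatteringMatrix_vertexStar_iff [DecidableEq E] [DecidableEq R]
    {Γ : SchrodingerGraph V E R} {c : E → ℝ} {k : ℝ} (hk : k ≠ 0)
    {f f' : (E ⊕ E) ⊕ R → ℝ → ℂ} (hf : Γ.IsJostFamily c k f f') (v : V)
    (S : Matrix {h : (E ⊕ E) ⊕ R // Γ.vtx h = v} {h : (E ⊕ E) ⊕ R // Γ.vtx h = v} ℂ) :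
    (Γ.vertexStar c v).IsScatteringMatrix k S ↔
      IsPlaneScattering (Γ.bc v) (fun h => f h.1 0) (fun h => f' h.1 0) S := by
  constructor
  · rintro ⟨fp, fm, hfp, hfm, hu⟩ i
    obtain ⟨u, u', ⟨hsol, hvc⟩, hur⟩ := hu i
    have hfp' : ∀ h : {h // Γ.vtx h = v}, ∀ x, 0 ≤ x → fp h x = f h.1 x := fun h =>
      (hf h.1).eqOn_of_isJost hk (hfp h)
    have hfm' : ∀ h : {h // Γ.vtx h = v}, ∀ x, 0 ≤ x → fm h x = star (f h.1 x) := fun h =>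
      (hf h.1).conj.eqOn_of_isJost (neg_ne_zero.2 hk) (hfm h)
    have hval : ∀ h : {h // Γ.vtx h = v}, ∀ x ∈ Set.Ici (0 : ℝ), u (Sum.inr h) x =
        S i h * f h.1 x + (Pi.single i 1 : _ → ℂ) h * star (f h.1 x) := by
      intro h x hx
      rw [hur h x hx, hfp' h x hx, Pi.single_apply]
      split_ifs with hhi
      · rw [hfm' h x hx]
        ring
      · ring
    have hder : ∀ h : {h // Γ.vtx h = v}, u' (Sum.inr h) 0 =
        S i h * f' h.1 0 + (Pi.single i 1 : _ → ℂ) h * star (f' h.1 0) := by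
      intro h
      have hk2 : IsSolution (Γ.splitPotential c h.1) (k ^ 2) (Set.Ici 0)
          (fun x => star (f h.1 x)) (fun x => star (f' h.1 x)) := (hf h.1).sol.conj
      exact (hsol (Sum.inr h)).deriv_eqOn (uniqueDiffOn_Ici 0)
        ((hf h.1).sol.linearComb hk2 (S i h) ((Pi.single i 1 : _ → ℂ) h)).1 (hval h) 0
        (Set.mem_Ici.2 le_rfl)
    have h1 := hvc ()
    have h2 : (fun h : {h // Γ.vtx h = v} => (u (Sum.inr h) 0, u' (Sum.inr h) 0)) ∈ Γ.bc v := h1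
    convert h2 using 1
    funext h
    rw [jostData_apply, hval h 0 (Set.mem_Ici.2 le_rfl), hder h]
  · intro hS
    refine ⟨fun h => f h.1, fun h x => star (f h.1 x), fun h => (hf h.1).isJost,
      fun h => (hf h.1).conj.isJost, fun i => ?_⟩
    refine ⟨Sum.elim Empty.elim fun h x => S i h * f h.1 x +
        (Pi.single i 1 : _ → ℂ) h * star (f h.1 x),
      Sum.elim Empty.elim fun h x => S i h * f' h.1 x +
        (Pi.single i 1 : _ → ℂ) h * star (f' h.1 x), ⟨?_, ?_⟩, ?_⟩
    · rintro (x | h)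
      · exact x.elim
      · exact (hf h.1).sol.linearComb (hf h.1).sol.conj _ _
    · intro w
      exact hS i
    · intro j x hx
      rw [Sum.elim_inr, Pi.single_apply]
      split_ifs <;> ring

theorem existsUnique_isScatteringMatrix_vertexStar [DecidableEq E] [DecidableEq R]
    {Γ : SchrodingerGraph V E R} {c : E → ℝ} {k : ℝ} (hk : k ≠ 0)
    {f f' : (E ⊕ E) ⊕ R → ℝ → ℂ} (hf : Γ.IsJostFamily c k f f') (v : V) :
    ∃! S, (Γ.vertexStar c v).IsScatteringMatrix k S := by
  simp only [isScatteringMatrix_vertexStar_iff hk hf]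
  exact (Γ.bc_lagrange v).existsUnique_isPlaneScattering hk fun h => hf.wronskian_zero h.1

theorem unionScatteringMatrix_vecMul (Γ : SchrodingerGraph V E R)
    (S : ∀ v : V, Matrix {h : (E ⊕ E) ⊕ R // Γ.vtx h = v} {h : (E ⊕ E) ⊕ R // Γ.vtx h = v} ℂ)
    (β : (E ⊕ E) ⊕ R → ℂ) (v : V) (j : {h : (E ⊕ E) ⊕ R // Γ.vtx h = v}) :
    Matrix.vecMul β (Γ.unionScatteringMatrix S) j.1 =
      Matrix.vecMul (fun h : {h // Γ.vtx h = v} => β h.1) (S v) j := by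
  obtain ⟨j, rfl⟩ := j
  simp only [Matrix.vecMul, dotProduct]
  have h1 : ∀ i, Γ.vtx i ≠ Γ.vtx j → Γ.unionScatteringMatrix S i j = 0 := fun i hi => by
    rw [unionScatteringMatrix, dif_neg (Ne.symm hi)]
  have h2 : ∀ v (i : {h // Γ.vtx h = v}) (j : {h // Γ.vtx h = v}),
      Γ.unionScatteringMatrix S i.1 j.1 = S v i j := by
    rintro v ⟨i, rfl⟩ ⟨j, hj⟩
    rw [unionScatteringMatrix, dif_pos hj]
  rw [← Finset.sum_filter_of_ne (p := fun i => Γ.vtx i = Γ.vtx j) fun i _ hi => by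
    by_contra h
    exact hi (by rw [h1 i h, mul_zero])]
  rw [Finset.sum_subtype (p := fun i => Γ.vtx i = Γ.vtx j) _ (by simp)]
  exact Finset.sum_congr rfl fun i _ => by rw [← h2 _ i ⟨j, rfl⟩]

/-- A wave on the union of the stars satisfies all boundary conditions iff its outgoing
coefficients come from the incoming ones by the scattering matrix. -/
theorem forall_jostData_mem_bc_iff [DecidableEq E] [DecidableEq R] {Γ : SchrodingerGraph V E R} {c : E → ℝ} {k : ℝ} (hk : k ≠ 0)
    {f f' : (E ⊕ E) ⊕ R → ℝ → ℂ} (hf : Γ.IsJostFamily c k f f')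
    {S : ∀ v : V, Matrix {h : (E ⊕ E) ⊕ R // Γ.vtx h = v} {h : (E ⊕ E) ⊕ R // Γ.vtx h = v} ℂ}
    (hS : ∀ v, (Γ.vertexStar c v).IsScatteringMatrix k (S v)) (α β : (E ⊕ E) ⊕ R → ℂ) :
    (∀ v, (fun h : {h // Γ.vtx h = v} =>
      jostData (fun h => f h 0) (fun h => f' h 0) (α, β) h.1) ∈ Γ.bc v) ↔
      α = Matrix.vecMul β (Γ.unionScatteringMatrix S) := by
  have h1 : ∀ v, (fun h : {h // Γ.vtx h = v} =>
      jostData (fun h => f h 0) (fun h => f' h 0) (α, β) h.1) ∈ Γ.bc v ↔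
      (fun h : {h // Γ.vtx h = v} => α h.1) =
        Matrix.vecMul (fun h : {h // Γ.vtx h = v} => β h.1) (S v) := fun v => by
    rw [← IsPlaneScattering.jostData_mem_iff (Γ.bc_lagrange v) hk
      (fun h => hf.wronskian_zero h.1) ((isScatteringMatrix_vertexStar_iff hk hf v _).1 (hS v))]
    rfl
  simp only [h1]
  constructor
  · intro h
    funext j
    rw [Γ.unionScatteringMatrix_vecMul S β (Γ.vtx j) ⟨j, rfl⟩]
    exact congrFun (h (Γ.vtx j)) ⟨j, rfl⟩
  · rintro rfl v
    funext j
    exact Γ.unionScatteringMatrix_vecMul S β v j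

end Star

end SchrodingerGraph

/-! ### Gluing solutions at a cut -/

section Glue

variable {q : ℝ → ℝ} {lam : ℝ} {g g' h h' : ℝ → ℂ}

theorem hasDerivWithinAt_ite_le {x₀ x₁ c x : ℝ} {D : ℂ} (h₀ : x₀ ≤ c) (h₁ : c ≤ x₁)
    (hgh : g c = h c) (hg : x ≤ c → HasDerivWithinAt g D (Set.Icc x₀ c) x)
    (hh : c ≤ x → HasDerivWithinAt h D (Set.Icc c x₁) x) :
    HasDerivWithinAt (fun y => if y ≤ c then g y else h y) D (Set.Icc x₀ x₁) x := by
  rw [← Set.Icc_union_Icc_eq_Icc h₀ h₁]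
  refine HasDerivWithinAt.union ?_ ?_
  · by_cases hx : x ≤ c
    · exact (hg hx).congr (fun y hy => if_pos hy.2) (if_pos hx)
    -- Away from the closed half interval the derivative within it is vacuous.
    · refine HasFDerivWithinAt.of_notMem_closure ?_
      rw [isClosed_Icc.closure_eq]
      exact fun h => hx h.2
  · by_cases hx : c ≤ x
    · have : ∀ y, c ≤ y → (if y ≤ c then g y else h y) = h y := fun y hy => by
        split_ifs with hyc
        · rw [le_antisymm hyc hy, hgh]
        · rfl
      exact (hh hx).congr (fun y hy => this y hy.1) (this x hx)
    · refine HasFDerivWithinAt.of_notMem_closure ?_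
      rw [isClosed_Icc.closure_eq]
      exact fun h => hx h.1

theorem IsSolution.glue {x₀ x₁ c : ℝ} (h₀ : x₀ ≤ c) (h₁ : c ≤ x₁)
    (hg : IsSolution q lam (Set.Icc x₀ c) g g') (hh : IsSolution q lam (Set.Icc c x₁) h h')
    (hc : g c = h c) (hc' : g' c = h' c) :
    IsSolution q lam (Set.Icc x₀ x₁) (fun y => if y ≤ c then g y else h y)
      (fun y => if y ≤ c then g' y else h' y) := by
  have hpos : ∀ (a b : ℝ → ℂ) y, a c = b c → c ≤ y → (if y ≤ c then a y else b y) = b y :=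
    fun a b y hab hy => by
      split_ifs with hyc
      · rw [le_antisymm hyc hy, hab]
      · rfl
  obtain ⟨F, hF, hgF⟩ := hg.2.2
  obtain ⟨G, hG, hhG⟩ := hh.2.2
  refine ⟨fun x hx => ?_, ?_, insert c (F ∪ G), (hF.union hG).insert c, fun x hx => ?_⟩
  · refine hasDerivWithinAt_ite_le h₀ h₁ hc (fun hxc => ?_) (fun hxc => ?_)
    · beta_reduce
      rw [if_pos hxc]
      exact hg.1 x ⟨hx.1, hxc⟩
    · beta_reduce
      rw [hpos _ _ x hc' hxc]
      exact hh.1 x ⟨hxc, hx.2⟩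
  · rw [← Set.Icc_union_Icc_eq_Icc h₀ h₁]
    refine ContinuousOn.union_of_isClosed ?_ ?_ isClosed_Icc isClosed_Icc
    · exact hg.2.1.congr fun y hy => if_pos hy.2
    · exact hh.2.1.congr fun y hy => hpos _ _ y hc' hy.1
  · obtain ⟨hx, hxF⟩ := hx
    simp only [Set.mem_insert_iff, Set.mem_union, not_or] at hxF
    refine hasDerivWithinAt_ite_le h₀ h₁ hc' (fun hxc => ?_) (fun hxc => ?_)
    · beta_reduce
      rw [if_pos hxc]
      exact hgF x ⟨⟨hx.1, hxc⟩, hxF.2.1⟩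
    · beta_reduce
      rw [hpos _ _ x hc hxc]
      exact hhG x ⟨⟨hxc, hx.2⟩, hxF.2.2⟩

theorem IsSolution.congr_potential {q' : ℝ → ℝ} {s : Set ℝ} (hg : IsSolution q lam s g g')
    (hq : ∀ x ∈ s, q x = q' x) : IsSolution q' lam s g g' := by
  obtain ⟨h1, h2, F, hF, h3⟩ := hg
  exact ⟨h1, h2, F, hF, fun x hx => hq x hx.1 ▸ h3 x hx⟩

theorem IsSolution.reflect {a d : ℝ}
    (hg : IsSolution (fun y => q (a - y)) lam (Set.Icc 0 d) g g') :
    IsSolution q lam (Set.Icc (a - d) a) (fun x => g (a - x)) (fun x => -g' (a - x)) := by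
  obtain ⟨h1, h2, F, hF, h3⟩ := hg
  have hmaps : Set.MapsTo (fun x => a - x) (Set.Icc (a - d) a) (Set.Icc 0 d) := fun x hx =>
    ⟨by linarith [hx.2], by linarith [hx.1]⟩
  have hder : ∀ x, HasDerivWithinAt (fun x => a - x) (-1) (Set.Icc (a - d) a) x := fun x =>
    ((hasDerivAt_id x).const_sub a).hasDerivWithinAt
  refine ⟨fun x hx => ?_, (h2.comp (by fun_prop) hmaps).neg, (fun x => a - x) '' F, hF.image _,
    fun x hx => ?_⟩
  · refine ((h1 _ (hmaps hx)).scomp x (hder x) hmaps).congr_deriv ?_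
    simp
  · have hxF : a - x ∉ F := fun h => hx.2 ⟨a - x, h, by simp⟩
    refine (((h3 _ ⟨hmaps hx.1, hxF⟩).scomp x (hder x) hmaps).neg).congr_deriv ?_
    simp

end Glue

/-! ### Solutions on an interior edge in terms of waves on its two halves. -/

section EdgeWave

/-- The function on an edge of length `a`, cut at `c`, made of waves on the two halves. -/
noncomputable def edgeWave (a c : ℝ) (ζ : ℂ) (f₁ f₂ : ℝ → ℂ) (w₁ w₂ : ℂ) (x : ℝ) : ℂ :=
  if x ≤ c then ζ * w₂ * f₁ x + w₁ * star (f₁ x)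
  else ζ * w₁ * f₂ (a - x) + w₂ * star (f₂ (a - x))

/-- The derivative of `edgeWave`. -/
noncomputable def edgeWaveDeriv (a c : ℝ) (ζ : ℂ) (f₁' f₂' : ℝ → ℂ) (w₁ w₂ : ℂ) (x : ℝ) : ℂ :=
  if x ≤ c then ζ * w₂ * f₁' x + w₁ * star (f₁' x)
  else -(ζ * w₁ * f₂' (a - x) + w₂ * star (f₂' (a - x)))

theorem edgeWave_linear (a c : ℝ) (ζ : ℂ) (f₁ f₂ : ℝ → ℂ) (w₁ w₂ : ℂ) (x : ℝ) :
    edgeWave a c ζ f₁ f₂ w₁ w₂ x =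
      w₁ * edgeWave a c ζ f₁ f₂ 1 0 x + w₂ * edgeWave a c ζ f₁ f₂ 0 1 x := by
  unfold edgeWave
  split_ifs <;> ring

theorem edgeWaveDeriv_linear (a c : ℝ) (ζ : ℂ) (f₁ f₂ : ℝ → ℂ) (w₁ w₂ : ℂ) (x : ℝ) :
    edgeWaveDeriv a c ζ f₁ f₂ w₁ w₂ x =
      w₁ * edgeWaveDeriv a c ζ f₁ f₂ 1 0 x + w₂ * edgeWaveDeriv a c ζ f₁ f₂ 0 1 x := by
  unfold edgeWaveDeriv
  split_ifs <;> ring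

variable {q : ℝ → ℝ} {a c k : ℝ} {f₁ f₁' f₂ f₂' : ℝ → ℂ}

theorem star_cexp_I_mul (k x : ℝ) :
    star (Complex.exp (Complex.I * k * x)) = Complex.exp (-(Complex.I * k * x)) := by
  simp [← Complex.exp_conj]

theorem star_I_mul_cexp_I_mul (k x : ℝ) :
    star (Complex.I * k * Complex.exp (Complex.I * k * x)) =
      -(Complex.I * k) * Complex.exp (-(Complex.I * k * x)) := by
  rw [star_mul', star_cexp_I_mul]
  simp

/-- This is where $\zeta=e^{-ika}$ comes from: at the cut, $\zeta$ times the outgoing wave of one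
half is the incoming wave of the other. -/
theorem cexp_edge (k a c : ℝ) :
    Complex.exp (-(Complex.I * k * a)) * Complex.exp (Complex.I * k * (a - c : ℝ)) =
      Complex.exp (-(Complex.I * k * c)) ∧
    Complex.exp (-(Complex.I * k * a)) * Complex.exp (Complex.I * k * c) =
      Complex.exp (-(Complex.I * k * (a - c : ℝ))) := by
  constructor <;> rw [← Complex.exp_add] <;> congr 1 <;> push_cast <;> ring

/-- The two halves of `edgeWave` match at the cut. -/
theorem edgeWave_match (hf₁ : IsJostPair (fun x => if x ≤ c then q x else 0) k f₁ f₁')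
    (hf₂ : IsJostPair (fun x => if x ≤ a - c then q (a - x) else 0) k f₂ f₂')
    (hc : c ∈ Set.Icc 0 a) (w₁ w₂ : ℂ) :
    Complex.exp (-(Complex.I * k * a)) * w₂ * f₁ c + w₁ * star (f₁ c) =
        Complex.exp (-(Complex.I * k * a)) * w₁ * f₂ (a - c) + w₂ * star (f₂ (a - c)) ∧
      Complex.exp (-(Complex.I * k * a)) * w₂ * f₁' c + w₁ * star (f₁' c) =
        -(Complex.exp (-(Complex.I * k * a)) * w₁ * f₂' (a - c) + w₂ * star (f₂' (a - c))) := by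
  -- The truncated potentials vanish beyond the cut, so there both Jost solutions are pure
  -- exponentials and the matching is that of free waves.
  obtain ⟨h1, h1'⟩ := hf₁.free c hc.1 (fun x hx => if_neg (not_le.2 hx)) c le_rfl
  obtain ⟨h2, h2'⟩ := hf₂.free (a - c) (sub_nonneg.2 hc.2) (fun x hx => if_neg (not_le.2 hx))
    (a - c) le_rfl
  obtain ⟨e1, e2⟩ := cexp_edge k a c
  rw [h1, h1', h2, h2', star_I_mul_cexp_I_mul, star_I_mul_cexp_I_mul, star_cexp_I_mul,
    star_cexp_I_mul]
  constructor
  · linear_combination w₂ * e2 - w₁ * e1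
  · linear_combination Complex.I * k * (w₂ * e2 + w₁ * e1)

theorem isSolution_edgeWave (hf₁ : IsJostPair (fun x => if x ≤ c then q x else 0) k f₁ f₁')
    (hf₂ : IsJostPair (fun x => if x ≤ a - c then q (a - x) else 0) k f₂ f₂')
    (hc : c ∈ Set.Icc 0 a) (w₁ w₂ : ℂ) :
    IsSolution q (k ^ 2) (Set.Icc 0 a)
      (edgeWave a c (Complex.exp (-(Complex.I * k * a))) f₁ f₂ w₁ w₂)
      (edgeWaveDeriv a c (Complex.exp (-(Complex.I * k * a))) f₁' f₂' w₁ w₂) := by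
  obtain ⟨m1, m2⟩ := edgeWave_match hf₁ hf₂ hc w₁ w₂
  have s1 := (((hf₁.sol.linearComb hf₁.sol.conj
    (Complex.exp (-(Complex.I * k * a)) * w₂) w₁)).mono
      (Set.Icc_subset_Ici_self : Set.Icc 0 c ⊆ Set.Ici 0)).congr_potential (q' := q) fun x hx => if_pos hx.2
  have s2 := (((hf₂.sol.linearComb hf₂.sol.conj
    (Complex.exp (-(Complex.I * k * a)) * w₁) w₂)).mono
      (Set.Icc_subset_Ici_self : Set.Icc 0 (a - c) ⊆ Set.Ici 0)).congr_potential (q' := fun y => q (a - y))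
      fun x hx => if_pos hx.2
  have s3 := s2.reflect
  rw [sub_sub_cancel] at s3
  exact s1.glue hc.1 hc.2 s3 m1 m2

theorem edgeWave_right (hf₁ : IsJostPair (fun x => if x ≤ c then q x else 0) k f₁ f₁')
    (hf₂ : IsJostPair (fun x => if x ≤ a - c then q (a - x) else 0) k f₂ f₂')
    (hc : c ∈ Set.Icc 0 a) (w₁ w₂ : ℂ) :
    edgeWave a c (Complex.exp (-(Complex.I * k * a))) f₁ f₂ w₁ w₂ a =
        Complex.exp (-(Complex.I * k * a)) * w₁ * f₂ 0 + w₂ * star (f₂ 0) ∧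
      -edgeWaveDeriv a c (Complex.exp (-(Complex.I * k * a))) f₁' f₂' w₁ w₂ a =
        Complex.exp (-(Complex.I * k * a)) * w₁ * f₂' 0 + w₂ * star (f₂' 0) := by
  obtain ⟨m1, m2⟩ := edgeWave_match hf₁ hf₂ hc w₁ w₂
  -- If the cut is at the far end, the first branch is the one evaluated at `a`, and the matching at
  -- the cut supplies the value.
  rcases hc.2.lt_or_eq with h | rfl
  · simp [edgeWave, edgeWaveDeriv, not_le.2 h]
  · rw [sub_self] at m1 m2
    simp only [edgeWave, edgeWaveDeriv, le_refl, if_true]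
    exact ⟨m1, neg_eq_iff_eq_neg.2 m2⟩

theorem edgeWave_cut (hf₁ : IsJostPair (fun x => if x ≤ c then q x else 0) k f₁ f₁')
    (hc : c ∈ Set.Icc 0 a) (ζ w₁ w₂ : ℂ) :
    edgeWave a c ζ f₁ f₂ w₁ w₂ c = ζ * w₂ * Complex.exp (Complex.I * k * c) +
        w₁ * Complex.exp (-(Complex.I * k * c)) ∧
      edgeWaveDeriv a c ζ f₁' f₂' w₁ w₂ c = Complex.I * k * (ζ * w₂ *
        Complex.exp (Complex.I * k * c) - w₁ * Complex.exp (-(Complex.I * k * c))) := by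
  obtain ⟨h1, h1'⟩ := hf₁.free c hc.1 (fun x hx => if_neg (not_le.2 hx)) c le_rfl
  simp only [edgeWave, edgeWaveDeriv, le_refl, if_true]
  rw [h1, h1', star_I_mul_cexp_I_mul, star_cexp_I_mul]
  exact ⟨rfl, by ring⟩

/-- The waves with amplitudes `(1, 0)` and `(0, 1)` have Wronskian $2ik\zeta\ne0$ at the cut, so
they span the solutions on the edge. -/
theorem exists_eq_edgeWave (hk : k ≠ 0)
    (hf₁ : IsJostPair (fun x => if x ≤ c then q x else 0) k f₁ f₁')
    (hf₂ : IsJostPair (fun x => if x ≤ a - c then q (a - x) else 0) k f₂ f₂')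
    (hc : c ∈ Set.Icc 0 a) {u u' : ℝ → ℂ} (hu : IsSolution q (k ^ 2) (Set.Icc 0 a) u u') :
    ∃ w₁ w₂, ∀ x ∈ Set.Icc 0 a,
      u x = edgeWave a c (Complex.exp (-(Complex.I * k * a))) f₁ f₂ w₁ w₂ x ∧
      u' x = edgeWaveDeriv a c (Complex.exp (-(Complex.I * k * a))) f₁' f₂' w₁ w₂ x := by
  obtain ⟨w₁, w₂, hw⟩ := (isSolution_edgeWave hf₁ hf₂ hc 1 0).exists_eq_linearComb
    (isSolution_edgeWave hf₁ hf₂ hc 0 1) hu Set.ordConnected_Icc hc (by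
      obtain ⟨e1, e1'⟩ := edgeWave_cut (f₂ := f₂) (f₂' := f₂') hf₁ hc
        (Complex.exp (-(Complex.I * k * a))) 1 0
      obtain ⟨e2, e2'⟩ := edgeWave_cut (f₂ := f₂) (f₂' := f₂') hf₁ hc
        (Complex.exp (-(Complex.I * k * a))) 0 1
      rw [e1, e1', e2, e2']
      have : (Complex.exp (-(Complex.I * k * a)) * 0 * Complex.exp (Complex.I * k * c) +
          1 * Complex.exp (-(Complex.I * k * c))) *
          (Complex.I * k * (Complex.exp (-(Complex.I * k * a)) * 1 *
            Complex.exp (Complex.I * k * c) - 0 * Complex.exp (-(Complex.I * k * c)))) -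
          Complex.I * k * (Complex.exp (-(Complex.I * k * a)) * 0 *
            Complex.exp (Complex.I * k * c) - 1 * Complex.exp (-(Complex.I * k * c))) *
          (Complex.exp (-(Complex.I * k * a)) * 1 * Complex.exp (Complex.I * k * c) +
            0 * Complex.exp (-(Complex.I * k * c))) =
          2 * Complex.I * k * Complex.exp (-(Complex.I * k * a)) := by
        linear_combination 2 * Complex.I * k * Complex.exp (-(Complex.I * k * a)) *
          cexp_mul_cexp_neg (Complex.I * k * c)
      rw [this]
      simp [hk])
  refine ⟨w₁, w₂, fun x hx => ?_⟩
  rw [edgeWave_linear, edgeWaveDeriv_linear]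
  exact hw x hx

theorem edgeWave_eq_zero_imp (hk : k ≠ 0)
    (hf₁ : IsJostPair (fun x => if x ≤ c then q x else 0) k f₁ f₁')
    (hf₂ : IsJostPair (fun x => if x ≤ a - c then q (a - x) else 0) k f₂ f₂')
    (ha : 0 < a) (hc : c ∈ Set.Icc 0 a) {w₁ w₂ : ℂ}
    (h : ∀ x ∈ Set.Icc 0 a,
      edgeWave a c (Complex.exp (-(Complex.I * k * a))) f₁ f₂ w₁ w₂ x = 0) :
    w₁ = 0 ∧ w₂ = 0 := by
  have h' := (isSolution_edgeWave hf₁ hf₂ hc w₁ w₂).deriv_eqOn (uniqueDiffOn_Icc ha)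
    (g := fun _ => 0) (g' := fun _ => 0) (fun x _ => hasDerivWithinAt_const _ _ _) h c hc
  have h0 := h c hc
  obtain ⟨e1, e1'⟩ := edgeWave_cut (f₂ := f₂) (f₂' := f₂') hf₁ hc
    (Complex.exp (-(Complex.I * k * a))) w₁ w₂
  rw [e1] at h0
  rw [e1'] at h'
  have h2 := (mul_eq_zero.1 h').resolve_left (by simp [hk])
  have hw1 : w₁ * Complex.exp (-(Complex.I * k * c)) = 0 := by
    linear_combination (h0 - h2) / 2
  have hw2 : Complex.exp (-(Complex.I * k * a)) * w₂ * Complex.exp (Complex.I * k * c) = 0 := by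
    linear_combination (h0 + h2) / 2
  simpa [Complex.exp_ne_zero] using And.intro hw1 hw2

end EdgeWave

/-! ### The operator and classical solutions -/

namespace SchrodingerGraph

section Operator

variable {V E R : Type*} [Fintype E] [Fintype R] [DecidableEq V] {Γ : SchrodingerGraph V E R}

theorem zero_mem_interval (Γ : SchrodingerGraph V E R) (i : E ⊕ R) : (0 : ℝ) ∈ Γ.interval i := by
  rcases i with e | r
  · exact ⟨le_rfl, (Γ.len_pos e).le⟩
  · exact Set.mem_Ici.2 le_rfl

theorem nonneg_of_mem_interval {i : E ⊕ R} {x : ℝ} (hx : x ∈ Γ.interval i) : 0 ≤ x := by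
  rcases i with e | r
  · exact hx.1
  · exact hx

theorem ordConnected_interval (Γ : SchrodingerGraph V E R) (i : E ⊕ R) :
    (Γ.interval i).OrdConnected := by
  rcases i with e | r
  · exact Set.ordConnected_Icc
  · exact Set.ordConnected_Ici

theorem measurableSet_interval (Γ : SchrodingerGraph V E R) (i : E ⊕ R) :
    MeasurableSet (Γ.interval i) := by
  rcases i with e | r
  · exact measurableSet_Icc
  · exact measurableSet_Ici

theorem Icc_subset_interval {i : E ⊕ R} {x : ℝ} (hx : x ∈ Γ.interval i) :
    Set.Icc 0 x ⊆ Γ.interval i :=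
  (Γ.ordConnected_interval i).out (Γ.zero_mem_interval i) hx

/-- Composing with the retraction extends a continuous function on the interval to the line, which
makes two-sided derivatives of integrals available at the endpoints. -/
theorem exists_retraction_interval (Γ : SchrodingerGraph V E R) (i : E ⊕ R) :
    ∃ p : ℝ → ℝ, Continuous p ∧ (∀ x, p x ∈ Γ.interval i) ∧ ∀ x ∈ Γ.interval i, p x = x := by
  rcases i with e | r
  · refine ⟨fun x => max 0 (min x (Γ.len e)), by fun_prop, fun x => ?_, fun x hx => ?_⟩
    · exact ⟨le_max_left _ _, max_le (Γ.len_pos e).le (min_le_right _ _)⟩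
    · beta_reduce
      rw [min_eq_left hx.2, max_eq_right hx.1]
  · exact ⟨fun x => max 0 x, by fun_prop, fun x => Set.mem_Ici.2 (le_max_left _ _),
      fun x hx => max_eq_right hx⟩

theorem eqOn_interval_of_ae_eq {i : E ⊕ R} {u v : ℝ → ℂ}
    (h : u =ᵐ[volume.restrict (Γ.interval i)] v) (hu : ContinuousOn u (Γ.interval i))
    (hv : ContinuousOn v (Γ.interval i)) : ∀ x ∈ Γ.interval i, u x = v x := by
  rcases i with e | r
  · exact Measure.eqOn_Icc_of_ae_eq volume (Γ.len_pos e).ne h hu hv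
  · intro x hx
    have hx0 : (0 : ℝ) ≤ x := hx
    have hsub : Set.Icc 0 (x + 1) ⊆ Set.Ici (0 : ℝ) := Set.Icc_subset_Ici_self
    exact Measure.eqOn_Icc_of_ae_eq volume (by positivity : x + 1 ≠ 0).symm
      (ae_restrict_of_ae_restrict_of_subset hsub h) (hu.mono hsub)
      (hv.mono hsub) ⟨hx0, by linarith⟩

theorem intervalIntegral_congr_ae_interval {i : E ⊕ R} {G H : ℝ → ℂ}
    (h : H =ᵐ[volume.restrict (Γ.interval i)] G) {x : ℝ} (hx : x ∈ Γ.interval i) :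
    ∫ t in (0 : ℝ)..x, H t = ∫ t in (0 : ℝ)..x, G t := by
  rw [intervalIntegral.integral_of_le (nonneg_of_mem_interval hx),
    intervalIntegral.integral_of_le (nonneg_of_mem_interval hx)]
  exact integral_congr_ae (ae_restrict_of_ae_restrict_of_subset
    (Set.Ioc_subset_Icc_self.trans (Icc_subset_interval hx)) h)

theorem eq_add_integral_of_hasDerivWithinAt {i : E ⊕ R} {u G H : ℝ → ℂ}
    (hG : ContinuousOn G (Γ.interval i)) (hu : ContinuousOn u (Γ.interval i)) {F : Set ℝ}
    (hF : F.Finite) (hd : ∀ x ∈ Γ.interval i \ F, HasDerivWithinAt u (G x) (Γ.interval i) x)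
    (h : H =ᵐ[volume.restrict (Γ.interval i)] G) :
    ∀ x ∈ Γ.interval i, u x = u 0 + ∫ t in (0 : ℝ)..x, H t := by
  intro x hx
  have hsub := Icc_subset_interval hx
  have hx0 := nonneg_of_mem_interval hx
  rw [intervalIntegral_congr_ae_interval h hx,
    integral_eq_of_hasDerivAt_off_countable_of_le u G hx0 hF.countable (hu.mono hsub)
    (fun t ht => by
      have h1 : Γ.interval i ∈ 𝓝 t := mem_of_superset (Icc_mem_nhds ht.1.1 ht.1.2) hsub
      exact (hd t ⟨mem_of_mem_nhds h1, ht.2⟩).hasDerivAt h1)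
    ((hG.mono (by rwa [Set.uIcc_of_le hx0])).intervalIntegrable)]
  ring

theorem hasDerivWithinAt_of_eq_add_integral {i : E ⊕ R} {u G H : ℝ → ℂ}
    (hG : ContinuousOn G (Γ.interval i)) (h : H =ᵐ[volume.restrict (Γ.interval i)] G)
    (hu : ∀ x ∈ Γ.interval i, u x = u 0 + ∫ t in (0 : ℝ)..x, H t) :
    ∀ x ∈ Γ.interval i, HasDerivWithinAt u (G x) (Γ.interval i) x := by
  obtain ⟨p, hp, hpI, hpx⟩ := Γ.exists_retraction_interval i
  have hGp : Continuous fun x => G (p x) := hG.comp_continuous hp hpI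
  intro x hx
  have h1 : HasDerivAt (fun x => u 0 + ∫ t in (0 : ℝ)..x, G (p t)) (G (p x)) x :=
    (intervalIntegral.integral_hasDerivAt_right (hGp.intervalIntegrable _ _)
      (hGp.stronglyMeasurableAtFilter _ _) hGp.continuousAt).const_add _
  have h2 : ∀ y ∈ Γ.interval i, u y = u 0 + ∫ t in (0 : ℝ)..y, G (p t) := fun y hy => by
    rw [hu y hy, intervalIntegral_congr_ae_interval h hy]
    congr 1
    refine intervalIntegral.integral_congr fun t ht => ?_
    rw [Set.uIcc_of_le (nonneg_of_mem_interval hy)] at ht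
    simp only [hpx t (Icc_subset_interval hy ht)]
  have h3 := h1.hasDerivWithinAt (s := Γ.interval i)
  rw [hpx x hx] at h3
  exact h3.congr h2 (h2 x hx)

/-- The source `g` is zero for eigenfunctions and nonzero when the range of `L - lam` is studied. -/
theorem operatorRel_of_classical (hΓ : Γ.RegularPotentials) {lam : ℝ} {ψ φ : Γ.HilbertSpace}
    {u u' g : E ⊕ R → ℝ → ℂ} (hg : ∀ i, ContinuousOn (g i) (Γ.interval i))
    (hψ : ∀ i, (ψ i : ℝ → ℂ) =ᵐ[volume.restrict (Γ.interval i)] u i)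
    (hφ : ∀ i, (φ i : ℝ → ℂ) =ᵐ[volume.restrict (Γ.interval i)] fun x => lam * u i x + g i x)
    (hu : ∀ i, ∀ x ∈ Γ.interval i, HasDerivWithinAt (u i) (u' i x) (Γ.interval i) x)
    (hu' : ∀ i, ContinuousOn (u' i) (Γ.interval i))
    (hd : ∀ i, ∃ F : Set ℝ, F.Finite ∧ ∀ x ∈ Γ.interval i \ F,
      HasDerivWithinAt (u' i) ((Γ.q i x - lam : ℂ) * u i x - g i x) (Γ.interval i) x)
    (hv : Γ.VertexConditions u u') : Γ.OperatorRel ψ φ := by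
  refine ⟨u, u', hψ, hu, fun i => ?_, hv⟩
  obtain ⟨F, hF, hFd⟩ := hd i
  have huc : ContinuousOn (u i) (Γ.interval i) := fun x hx => (hu i x hx).continuousWithinAt
  refine eq_add_integral_of_hasDerivWithinAt (G := fun x => (Γ.q i x - lam : ℂ) * u i x - g i x)
    ?_ (hu' i) hF hFd ?_
  · exact (((Complex.continuous_ofReal.comp_continuousOn (hΓ.1 i)).sub
      continuousOn_const).mul huc).sub (hg i)
  · filter_upwards [hφ i] with x hx
    rw [hx]
    ring

/-- With a continuous source the integrand in `OperatorRel` agrees almost everywhere with a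
continuous function, so the equation holds at every point. -/
theorem OperatorRel.exists_classical (hΓ : Γ.RegularPotentials) {lam : ℝ} {ψ φ : Γ.HilbertSpace}
    (h : Γ.OperatorRel ψ φ) {g : E ⊕ R → ℝ → ℂ} (hg : ∀ i, ContinuousOn (g i) (Γ.interval i))
    (hφ : ∀ i, (φ i : ℝ → ℂ) =ᵐ[volume.restrict (Γ.interval i)]
      fun x => lam * (ψ i : ℝ → ℂ) x + g i x) :
    ∃ u u' : E ⊕ R → ℝ → ℂ,
      (∀ i, (ψ i : ℝ → ℂ) =ᵐ[volume.restrict (Γ.interval i)] u i) ∧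
      (∀ i, ∀ x ∈ Γ.interval i, HasDerivWithinAt (u i) (u' i x) (Γ.interval i) x) ∧
      (∀ i, ∀ x ∈ Γ.interval i,
        HasDerivWithinAt (u' i) ((Γ.q i x - lam : ℂ) * u i x - g i x) (Γ.interval i) x) ∧
      Γ.VertexConditions u u' := by
  obtain ⟨u, u', hψ, hu, hint, hv⟩ := h
  refine ⟨u, u', hψ, hu, fun i => ?_, hv⟩
  have huc : ContinuousOn (u i) (Γ.interval i) := fun x hx => (hu i x hx).continuousWithinAt
  refine hasDerivWithinAt_of_eq_add_integral
    (G := fun x => (Γ.q i x - lam : ℂ) * u i x - g i x) ?_ ?_ (hint i)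
  · exact (((Complex.continuous_ofReal.comp_continuousOn (hΓ.1 i)).sub
      continuousOn_const).mul huc).sub (hg i)
  · filter_upwards [hφ i, hψ i] with x hx hx'
    rw [hx, hx']
    ring

end Operator

/-! ### Eigenvalues -/

section Eigenvalue

variable {V E R : Type*} [Fintype E] [Fintype R] [DecidableEq V] {Γ : SchrodingerGraph V E R}

/-- The coefficients of the outgoing waves that fit incoming waves with coefficients `w` on the
halves of the interior edges. -/
noncomputable def linkedWave (Γ : SchrodingerGraph V E R) (k : ℝ) (w : E ⊕ E → ℂ) :
    (E ⊕ E) ⊕ R → ℂ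
  | Sum.inl (Sum.inl e) => Complex.exp (-(Complex.I * k * Γ.len e)) * w (Sum.inr e)
  | Sum.inl (Sum.inr e) => Complex.exp (-(Complex.I * k * Γ.len e)) * w (Sum.inl e)
  | Sum.inr _ => 0

/-- A function on the graph that vanishes on the rays, and is given by `edgeWave` on the edges. -/
noncomputable def graphWave (Γ : SchrodingerGraph V E R) (c : E → ℝ) (k : ℝ)
    (f : (E ⊕ E) ⊕ R → ℝ → ℂ) (w : E ⊕ E → ℂ) : E ⊕ R → ℝ → ℂ
  | Sum.inl e => edgeWave (Γ.len e) (c e) (Complex.exp (-(Complex.I * k * Γ.len e)))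
      (f (Sum.inl (Sum.inl e))) (f (Sum.inl (Sum.inr e))) (w (Sum.inl e)) (w (Sum.inr e))
  | Sum.inr _ => 0

/-- The derivative of `graphWave`. -/
noncomputable def graphWaveDeriv (Γ : SchrodingerGraph V E R) (c : E → ℝ) (k : ℝ)
    (f' : (E ⊕ E) ⊕ R → ℝ → ℂ) (w : E ⊕ E → ℂ) : E ⊕ R → ℝ → ℂ
  | Sum.inl e => edgeWaveDeriv (Γ.len e) (c e) (Complex.exp (-(Complex.I * k * Γ.len e)))
      (f' (Sum.inl (Sum.inl e))) (f' (Sum.inl (Sum.inr e))) (w (Sum.inl e)) (w (Sum.inr e))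
  | Sum.inr _ => 0

variable {c : E → ℝ} {k : ℝ} {f f' : (E ⊕ E) ⊕ R → ℝ → ℂ}

theorem IsJostFamily.isSolution_graphWave (hf : Γ.IsJostFamily c k f f')
    (hc : ∀ e, c e ∈ Set.Icc 0 (Γ.len e)) (w : E ⊕ E → ℂ) (i : E ⊕ R) :
    IsSolution (Γ.q i) (k ^ 2) (Γ.interval i) (Γ.graphWave c k f w i)
      (Γ.graphWaveDeriv c k f' w i) := by
  rcases i with e | r
  · exact isSolution_edgeWave (hf (Sum.inl (Sum.inl e))) (hf (Sum.inl (Sum.inr e))) (hc e) _ _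
  · exact ⟨fun x _ => hasDerivWithinAt_const _ _ _, continuousOn_const, ∅, Set.finite_empty,
      fun x _ => (hasDerivWithinAt_const x _ (0 : ℂ)).congr_deriv (by simp [graphWave])⟩

theorem IsJostFamily.boundaryData_graphWave (hf : Γ.IsJostFamily c k f f')
    (hc : ∀ e, c e ∈ Set.Icc 0 (Γ.len e)) (w : E ⊕ E → ℂ) (h : (E ⊕ E) ⊕ R) :
    Γ.boundaryData (Γ.graphWave c k f w) (Γ.graphWaveDeriv c k f' w) h =
      jostData (fun h => f h 0) (fun h => f' h 0) (Γ.linkedWave k w, Sum.elim w 0) h := by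
  rcases h with (e | e) | r
  · exact Prod.ext (if_pos (hc e).1) (if_pos (hc e).1)
  · have := edgeWave_right (hf (Sum.inl (Sum.inl e))) (hf (Sum.inl (Sum.inr e))) (hc e)
      (w (Sum.inl e)) (w (Sum.inr e))
    exact Prod.ext this.1 this.2
  · simp [boundaryData, jostData_apply, linkedWave, graphWave, graphWaveDeriv]

theorem boundaryData_congr {u u' v v' : E ⊕ R → ℝ → ℂ}
    (h : ∀ i, ∀ x ∈ Γ.interval i, u i x = v i x ∧ u' i x = v' i x) :
    Γ.boundaryData u u' = Γ.boundaryData v v' := by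
  funext j
  rcases j with (e | e) | r
  · have := h _ _ (Γ.zero_mem_interval (Sum.inl e))
    exact Prod.ext this.1 this.2
  · have := h (Sum.inl e) (Γ.len e) ⟨(Γ.len_pos e).le, le_rfl⟩
    exact Prod.ext this.1 (congrArg (fun z => -z) this.2)
  · have := h _ _ (Γ.zero_mem_interval (Sum.inr r))
    exact Prod.ext this.1 this.2

theorem integrableOn_norm_sq_of_ae_eq {i : E ⊕ R} (ψ : Lp ℂ 2 (volume.restrict (Γ.interval i)))
    {v : ℝ → ℂ} (h : (ψ : ℝ → ℂ) =ᵐ[volume.restrict (Γ.interval i)] v) :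
    IntegrableOn (fun x => ‖v x‖ ^ 2) (Γ.interval i) := by
  have h1 := ((memLp_congr_ae h).1 (Lp.memLp ψ))
  exact h1.integrable_norm_pow two_ne_zero

theorem IsJostFamily.eq_zero_of_sq_integrable (hf : Γ.IsJostFamily c k f f') (hk : k ≠ 0) {r : R}
    {u u' : ℝ → ℂ} (hu : IsSolution (Γ.q (Sum.inr r)) (k ^ 2) (Set.Ici 0) u u')
    (hi : IntegrableOn (fun x => ‖u x‖ ^ 2) (Set.Ici 0)) :
    ∀ x, 0 ≤ x → u x = 0 ∧ u' x = 0 := by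
  obtain ⟨a, b, hab⟩ := (hf (Sum.inr r)).exists_eq hk hu
  obtain ⟨rfl, rfl⟩ := (hf (Sum.inr r)).eq_zero_of_sq_integrable (a := a) (b := b) hk
    (hi.congr_fun (fun x hx => by simp only [(hab x hx).1]) measurableSet_Ici)
  intro x hx
  simpa using hab x hx

/-- Square integrability kills an eigenfunction on the rays, and on the edges it is an `edgeWave`;
its boundary data are those of incoming amplitudes `w` with linked outgoing ones. Conversely such a
wave is bounded on compact edges, hence in the Hilbert space. -/
theorem isEigenvalue_iff (hΓ : Γ.RegularPotentials) (hc : ∀ e, c e ∈ Set.Icc 0 (Γ.len e))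
    (hk : k ≠ 0) (hf : Γ.IsJostFamily c k f f') :
    Γ.IsEigenvalue (k ^ 2) ↔ ∃ w : E ⊕ E → ℂ, w ≠ 0 ∧ ∀ v, (fun h : {h // Γ.vtx h = v} =>
      jostData (fun h => f h 0) (fun h => f' h 0) (Γ.linkedWave k w, Sum.elim w 0) h.1) ∈
        Γ.bc v := by
  constructor
  · rintro ⟨ψ, hψ0, hψ⟩
    obtain ⟨u, u', hψu, hu, hu', hv⟩ := hψ.exists_classical hΓ (lam := k ^ 2) (g := fun _ _ => 0)
      (fun i => continuousOn_const) (fun i => by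
        filter_upwards [Lp.coeFn_smul ((k ^ 2 : ℝ) : ℂ) (ψ i)] with x hx
        rw [PiLp.smul_apply, hx, add_zero]
        rfl)
    have hsol : ∀ i, IsSolution (Γ.q i) (k ^ 2) (Γ.interval i) (u i) (u' i) := fun i =>
      ⟨hu i, fun x hx => (hu' i x hx).continuousWithinAt, ∅, Set.finite_empty, fun x hx => by
        simpa using hu' i x hx.1⟩
    have hray : ∀ r x, 0 ≤ x → u (Sum.inr r) x = 0 ∧ u' (Sum.inr r) x = 0 := fun r =>
      hf.eq_zero_of_sq_integrable hk (hsol (Sum.inr r))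
        (integrableOn_norm_sq_of_ae_eq (ψ (Sum.inr r)) (hψu _))
    choose w₁ w₂ hw using fun e => exists_eq_edgeWave hk (hf (Sum.inl (Sum.inl e)))
      (hf (Sum.inl (Sum.inr e))) (hc e) (hsol (Sum.inl e))
    have huw : ∀ i, ∀ x ∈ Γ.interval i, u i x = Γ.graphWave c k f (Sum.elim w₁ w₂) i x ∧
        u' i x = Γ.graphWaveDeriv c k f' (Sum.elim w₁ w₂) i x := by
      rintro (e | r) x hx
      · exact hw e x hx
      · exact hray r x hx
    refine ⟨Sum.elim w₁ w₂, fun h0 => hψ0 ?_, fun v => ?_⟩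
    · ext1 i
      refine Lp.ext ?_
      refine (hψu i).trans (EventuallyEq.trans ?_ (Lp.coeFn_zero ℂ 2 _).symm)
      filter_upwards [ae_restrict_mem (Γ.measurableSet_interval i)] with x hx
      rw [(huw i x hx).1, h0]
      rcases i with e | r
      · simp [graphWave, edgeWave]
      · rfl
    · have h1 := hv v
      rw [boundaryData_congr huw] at h1
      simpa only [hf.boundaryData_graphWave hc] using h1
  · rintro ⟨w, hw0, hw⟩
    have hsol := hf.isSolution_graphWave hc w
    have hmem : ∀ i, MemLp (Γ.graphWave c k f w i) 2 (volume.restrict (Γ.interval i)) := by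
      rintro (e | r)
      · obtain ⟨C, hC⟩ := isCompact_Icc.exists_bound_of_continuousOn (hsol (Sum.inl e)).continuousOn
        have : IsFiniteMeasure (volume.restrict (Γ.interval (Sum.inl e))) :=
          ⟨by simp [interval]⟩
        refine MemLp.of_bound
          ((hsol (Sum.inl e)).continuousOn.aestronglyMeasurable (Γ.measurableSet_interval _)) C ?_
        filter_upwards [ae_restrict_mem (Γ.measurableSet_interval (Sum.inl e))] with x hx
        exact hC x hx
      · exact MemLp.zero
    set ψ : Γ.HilbertSpace := WithLp.toLp 2 fun i => (hmem i).toLp _ with hψ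
    have hψu : ∀ i, (ψ i : ℝ → ℂ) =ᵐ[volume.restrict (Γ.interval i)] Γ.graphWave c k f w i :=
      fun i => (hmem i).coeFn_toLp
    refine ⟨ψ, fun h0 => hw0 ?_, ?_⟩
    · have h1 : ∀ e, w (Sum.inl e) = 0 ∧ w (Sum.inr e) = 0 := fun e => by
        refine edgeWave_eq_zero_imp hk (hf (Sum.inl (Sum.inl e))) (hf (Sum.inl (Sum.inr e)))
          (Γ.len_pos e) (hc e) ?_
        refine eqOn_interval_of_ae_eq (i := Sum.inl e) ((hψu (Sum.inl e)).symm.trans ?_)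
          (hsol (Sum.inl e)).continuousOn continuousOn_const
        rw [h0]
        exact Lp.coeFn_zero ℂ 2 _
      funext x
      rcases x with e | e
      · exact (h1 e).1
      · exact (h1 e).2
    · refine operatorRel_of_classical hΓ (lam := k ^ 2) (g := fun _ _ => 0)
        (fun i => continuousOn_const) hψu (fun i => ?_) (fun i => (hsol i).1)
        (fun i => (hsol i).2.1) (fun i => ?_) (fun v => ?_)
      · filter_upwards [Lp.coeFn_smul ((k ^ 2 : ℝ) : ℂ) (ψ i), hψu i] with x hx hx'
        rw [PiLp.smul_apply, hx, add_zero, Pi.smul_apply, hx']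
        rfl
      · simpa using (hsol i).2.2
      · simpa only [hf.boundaryData_graphWave hc] using hw v

end Eigenvalue

end SchrodingerGraph

/-! ### The determinant criterion -/

/-- Singularity of a block of $B$ thus becomes a fixed-vector condition for the corresponding block
of $ST^{\star}$. -/
theorem canonicalTransform_mul_conjTranspose_toBlocks₁₂ {m : Type*} [Fintype m] [DecidableEq m]
    (S T : Matrix m m ℂ) :
    (canonicalTransform S * (canonicalTransform T).conjTranspose).toBlocks₁₂ =
      (Complex.I / 2) • (S * T.conjTranspose - 1) := by
  unfold canonicalTransform
  rw [Matrix.conjTranspose_smul, Matrix.fromBlocks_conjTranspose, Matrix.smul_mul,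
    Matrix.mul_smul, Matrix.fromBlocks_multiply, smul_smul, Matrix.fromBlocks_smul,
    Matrix.toBlocks_fromBlocks₁₂]
  simp only [Matrix.conjTranspose_neg, Matrix.conjTranspose_smul, Matrix.conjTranspose_sub,
    Matrix.conjTranspose_add, Matrix.conjTranspose_one, Complex.star_def, Complex.conj_I,
    neg_smul, neg_neg, Matrix.mul_smul, Matrix.smul_mul]
  rw [← smul_add, smul_smul]
  have : (S + 1) * (T.conjTranspose - 1) + (S - 1) * (T.conjTranspose + 1) =
      (2 : ℂ) • (S * T.conjTranspose - 1) := by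
    rw [two_smul]
    noncomm_ring
  rw [this, smul_smul]
  congr 1
  have h2 : (starRingEnd ℂ) 2 = 2 := map_ofNat _ 2
  simp [h2]
  ring

namespace SchrodingerGraph

/-! ### Conservation of flux on the union of the stars. -/

section Flux

variable {V E R : Type*} [Fintype V] [Fintype E] [Fintype R] [DecidableEq V]
  {Γ : SchrodingerGraph V E R}

/-- The boundary form summed over all edge ends vanishes on the boundary conditions. -/
theorem boundaryForm_eq_zero_of_forall_mem_bc {φ : (E ⊕ E) ⊕ R → ℂ × ℂ}
    (h : ∀ v, (fun h : {h // Γ.vtx h = v} => φ h.1) ∈ Γ.bc v) : boundaryForm φ φ = 0 := by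
  unfold boundaryForm
  rw [← Fintype.sum_fiberwise Γ.vtx]
  exact Finset.sum_eq_zero fun v _ => (Γ.bc_lagrange v _).1 (h v) _ (h v)

theorem sum_norm_sq_eq_of_forall_mem_bc {k : ℝ} (hk : k ≠ 0) {a b : (E ⊕ E) ⊕ R → ℂ}
    (hW : ∀ h, star (a h) * b h - star (b h) * a h = 2 * Complex.I * k)
    {α β : (E ⊕ E) ⊕ R → ℂ}
    (h : ∀ v, (fun h : {h // Γ.vtx h = v} => jostData a b (α, β) h.1) ∈ Γ.bc v) :
    ∑ i, ‖α i‖ ^ 2 = ∑ i, ‖β i‖ ^ 2 :=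
  sum_norm_sq_eq_of_boundaryForm_eq_zero hk hW (boundaryForm_eq_zero_of_forall_mem_bc h)

end Flux

section Determinant

variable {V E R : Type*} [Fintype E] [Fintype R] [DecidableEq V] [DecidableEq E] [DecidableEq R]

theorem matrixB_eq (Γ : SchrodingerGraph V E R) (k : ℝ)
    (S : ∀ v : V, Matrix {h : (E ⊕ E) ⊕ R // Γ.vtx h = v} {h : (E ⊕ E) ⊕ R // Γ.vtx h = v} ℂ) :
    Γ.matrixB k S = (Complex.I / 2) • ((Γ.unionScatteringMatrix S *
      (Γ.linkingMatrix k).conjTranspose).submatrix Sum.inl Sum.inl - 1) := by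
  have h := canonicalTransform_mul_conjTranspose_toBlocks₁₂ (Γ.unionScatteringMatrix S)
    (Γ.linkingMatrix k)
  ext i j
  have h1 := congrFun (congrFun h (Sum.inl i)) (Sum.inl j)
  simp only [Matrix.toBlocks₁₂, Matrix.of_apply, Matrix.smul_apply, Matrix.sub_apply] at h1
  simp only [matrixB, Matrix.submatrix_apply, Matrix.smul_apply, Matrix.sub_apply]
  rw [h1]
  simp [Matrix.one_apply]

theorem mul_linkingMatrix_conjTranspose_apply (Γ : SchrodingerGraph V E R) (k : ℝ)
    (M : Matrix ((E ⊕ E) ⊕ R) ((E ⊕ E) ⊕ R) ℂ) (i : (E ⊕ E) ⊕ R) (e : E) :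
    (M * (Γ.linkingMatrix k).conjTranspose) i (Sum.inl (Sum.inl e)) =
        M i (Sum.inl (Sum.inr e)) * Complex.exp (Complex.I * k * Γ.len e) ∧
      (M * (Γ.linkingMatrix k).conjTranspose) i (Sum.inl (Sum.inr e)) =
        M i (Sum.inl (Sum.inl e)) * Complex.exp (Complex.I * k * Γ.len e) := by
  constructor <;>
  · rw [Matrix.mul_apply, Fintype.sum_sum_type, Fintype.sum_sum_type]
    simp [linkingMatrix, Matrix.conjTranspose_apply, Matrix.diagonal_apply, apply_ite,
      ← Complex.exp_conj]

/-- Multiplying by $T^{\star}$ exchanges the two halves of each edge and undoes the phase $\zeta$,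
so being fixed by the block of $ST^{\star}$ is the linking condition. The exchange also accounts for
the swapped components at the end. -/
theorem vecMul_matrixB_eq_zero_iff (Γ : SchrodingerGraph V E R) (k : ℝ)
    (S : ∀ v : V, Matrix {h : (E ⊕ E) ⊕ R // Γ.vtx h = v} {h : (E ⊕ E) ⊕ R // Γ.vtx h = v} ℂ)
    (w : E ⊕ E → ℂ) :
    Matrix.vecMul w (Γ.matrixB k S) = 0 ↔ ∀ j : E ⊕ E,
      Matrix.vecMul (Sum.elim w 0) (Γ.unionScatteringMatrix S) (Sum.inl j) =
        Γ.linkedWave k w (Sum.inl j) := by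
  have hI : (Complex.I / 2 : ℂ) ≠ 0 := by simp
  rw [matrixB_eq, Matrix.vecMul_smul, smul_eq_zero_iff_right hI, Matrix.vecMul_sub,
    Matrix.vecMul_one, sub_eq_zero, funext_iff]
  have h1 : ∀ (M : Matrix ((E ⊕ E) ⊕ R) ((E ⊕ E) ⊕ R) ℂ) (j : (E ⊕ E) ⊕ R),
      Matrix.vecMul (Sum.elim w 0) M j = ∑ i, w i * M (Sum.inl i) j := fun M j => by
    rw [Matrix.vecMul, dotProduct, Fintype.sum_sum_type]
    simp
  have h2 : ∀ (e : E) (z z' : ℂ), z * Complex.exp (Complex.I * k * Γ.len e) = z' ↔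
      z = Complex.exp (-(Complex.I * k * Γ.len e)) * z' := fun e z z' => by
    have h3 := cexp_mul_cexp_neg (Complex.I * k * Γ.len e)
    constructor
    · rintro rfl
      linear_combination -z * h3
    · rintro rfl
      linear_combination z' * h3
  have h4 : ∀ e, Matrix.vecMul w ((Γ.unionScatteringMatrix S *
      (Γ.linkingMatrix k).conjTranspose).submatrix Sum.inl Sum.inl) (Sum.inl e) = w (Sum.inl e) ↔
      Matrix.vecMul (Sum.elim w 0) (Γ.unionScatteringMatrix S) (Sum.inl (Sum.inr e)) =
        Γ.linkedWave k w (Sum.inl (Sum.inr e)) := fun e => by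
    rw [h1, linkedWave, ← h2, Finset.sum_mul, Matrix.vecMul, dotProduct]
    simp only [Matrix.submatrix_apply, (Γ.mul_linkingMatrix_conjTranspose_apply k _ _ e).1,
      mul_assoc]
  have h5 : ∀ e, Matrix.vecMul w ((Γ.unionScatteringMatrix S *
      (Γ.linkingMatrix k).conjTranspose).submatrix Sum.inl Sum.inl) (Sum.inr e) = w (Sum.inr e) ↔
      Matrix.vecMul (Sum.elim w 0) (Γ.unionScatteringMatrix S) (Sum.inl (Sum.inl e)) =
        Γ.linkedWave k w (Sum.inl (Sum.inl e)) := fun e => by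
    rw [h1, linkedWave, ← h2, Finset.sum_mul, Matrix.vecMul, dotProduct]
    simp only [Matrix.submatrix_apply, (Γ.mul_linkingMatrix_conjTranspose_apply k _ _ e).2,
      mul_assoc]
  rw [Sum.forall, Sum.forall, and_comm]
  exact and_congr (forall_congr' h5) (forall_congr' h4)

variable [Fintype V]

/-- A null vector controls only the linking rays. The outgoing amplitudes on the original rays
vanish by a flux count. -/
theorem det_matrixB_eq_zero_iff {Γ : SchrodingerGraph V E R} {c : E → ℝ} {k : ℝ} (hk : k ≠ 0)
    {f f' : (E ⊕ E) ⊕ R → ℝ → ℂ} (hf : Γ.IsJostFamily c k f f')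
    {S : ∀ v : V, Matrix {h : (E ⊕ E) ⊕ R // Γ.vtx h = v} {h : (E ⊕ E) ⊕ R // Γ.vtx h = v} ℂ}
    (hS : ∀ v, (Γ.vertexStar c v).IsScatteringMatrix k (S v)) :
    (Γ.matrixB k S).det = 0 ↔ ∃ w : E ⊕ E → ℂ, w ≠ 0 ∧
      ∀ v, (fun h : {h // Γ.vtx h = v} =>
        jostData (fun h => f h 0) (fun h => f' h 0) (Γ.linkedWave k w, Sum.elim w 0) h.1) ∈
          Γ.bc v := by
  rw [← Matrix.exists_vecMul_eq_zero_iff]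
  refine exists_congr fun w => and_congr_right fun _ => ?_
  rw [vecMul_matrixB_eq_zero_iff, forall_jostData_mem_bc_iff hk hf hS]
  refine ⟨fun h => ?_, fun h j => by rw [← h]⟩
  set α := Matrix.vecMul (Sum.elim w 0) (Γ.unionScatteringMatrix S) with hα
  have h1 := sum_norm_sq_eq_of_forall_mem_bc hk hf.wronskian_zero
    ((forall_jostData_mem_bc_iff hk hf hS α (Sum.elim w 0)).2 hα)
  rw [Fintype.sum_sum_type fun i => ‖α i‖ ^ 2,
    Fintype.sum_sum_type fun i => ‖(Sum.elim w 0 : _ → ℂ) i‖ ^ 2] at h1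
  -- Since $|\zeta|=1$, the linking rays already carry the whole incoming flux; nothing is left for
  -- the original rays.
  have h2 : ∑ j : E ⊕ E, ‖α (Sum.inl j)‖ ^ 2 = ∑ j, ‖w j‖ ^ 2 := by
    simp only [h]
    rw [Fintype.sum_sum_type, Fintype.sum_sum_type, add_comm]
    simp [linkedWave, norm_cexp_neg_I_mul]
  rw [h2] at h1
  simp only [Sum.elim_inl, Sum.elim_inr, Pi.zero_apply, norm_zero, ne_eq, OfNat.ofNat_ne_zero,
    not_false_eq_true, zero_pow, Finset.sum_const_zero, add_zero, add_eq_left] at h1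
  rw [Finset.sum_eq_zero_iff_of_nonneg fun i _ => sq_nonneg _] at h1
  funext j
  rcases j with j | r
  · exact (h j).symm
  · have h3 : α (Sum.inr r) = 0 := by simpa using h1 r (Finset.mem_univ r)
    rw [h3]
    rfl

end Determinant

end SchrodingerGraph

/-! ### A bump and its rescalings -/

section Bump

/-- The function `1 / (1 + x ^ 2)`. -/
noncomputable def bump (x : ℝ) : ℝ := (1 + x ^ 2)⁻¹

/-- The derivative of `bump`. -/
noncomputable def bumpDeriv (x : ℝ) : ℝ := -(2 * x) * (1 + x ^ 2)⁻¹ ^ 2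

/-- The second derivative of `bump`. -/
noncomputable def bumpDeriv₂ (x : ℝ) : ℝ := (6 * x ^ 2 - 2) * (1 + x ^ 2)⁻¹ ^ 3

/-- A square integrable majorant. -/
noncomputable def bumpWeight (x : ℝ) : ℝ := (1 + x ^ 2) ^ (-(3 / 8) : ℝ)

theorem hasDerivAt_bump (x : ℝ) : HasDerivAt bump (bumpDeriv x) x := by
  have h0 : (1 + x ^ 2 : ℝ) ≠ 0 := by positivity
  have h := (((hasDerivAt_id x).fun_pow 2).const_add 1).fun_inv h0
  refine HasDerivAt.congr_deriv (f := bump) h ?_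
  simp only [bumpDeriv, id]
  field_simp
  norm_num
  ring

theorem hasDerivAt_bumpDeriv (x : ℝ) : HasDerivAt bumpDeriv (bumpDeriv₂ x) x := by
  have h0 : (1 + x ^ 2 : ℝ) ≠ 0 := by positivity
  have h := (((hasDerivAt_id x).const_mul 2).neg).mul ((hasDerivAt_bump x).fun_pow 2)
  refine HasDerivAt.congr_deriv (f := bumpDeriv) h ?_
  have h1 : (1 + x ^ 2)⁻¹ * (1 + x ^ 2) = 1 := inv_mul_cancel₀ h0
  simp only [bumpDeriv, bumpDeriv₂, bump, id, Pi.neg_apply, Nat.cast_ofNat]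
  linear_combination 2 * (1 + x ^ 2)⁻¹ ^ 2 * h1

theorem continuous_bump : Continuous bump :=
  continuous_iff_continuousAt.2 fun x => (hasDerivAt_bump x).continuousAt

theorem continuous_bumpDeriv : Continuous bumpDeriv :=
  continuous_iff_continuousAt.2 fun x => (hasDerivAt_bumpDeriv x).continuousAt

theorem continuous_bumpDeriv₂ : Continuous bumpDeriv₂ := by
  have h : Continuous fun x => (6 * x ^ 2 - 2) * bump x ^ 3 :=
    (by fun_prop : Continuous fun x : ℝ => 6 * x ^ 2 - 2).mul (continuous_bump.pow 3)
  exact h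

theorem bump_pos (x : ℝ) : 0 < bump x := by
  unfold bump
  positivity

theorem abs_bumpDeriv_le (x : ℝ) : |bumpDeriv x| ≤ bump x := by
  have h0 : (0 : ℝ) < 1 + x ^ 2 := by positivity
  have h1 : |2 * x| ≤ 1 + x ^ 2 := abs_le.2 ⟨by nlinarith [sq_nonneg (x + 1)],
    by nlinarith [sq_nonneg (x - 1)]⟩
  rw [bumpDeriv, bump, abs_mul, abs_neg, abs_of_nonneg (a := (1 + x ^ 2)⁻¹ ^ 2) (by positivity)]
  calc |2 * x| * (1 + x ^ 2)⁻¹ ^ 2 ≤ (1 + x ^ 2) * (1 + x ^ 2)⁻¹ ^ 2 := by gcongr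
    _ = _ := by field_simp

theorem abs_bumpDeriv₂_le (x : ℝ) : |bumpDeriv₂ x| ≤ 6 * bump x := by
  have h0 : (0 : ℝ) < 1 + x ^ 2 := by positivity
  have h1 : |6 * x ^ 2 - 2| ≤ 6 * (1 + x ^ 2) ^ 2 := abs_le.2 ⟨by nlinarith [sq_nonneg x],
    by nlinarith [sq_nonneg x, sq_nonneg (x ^ 2)]⟩
  rw [bumpDeriv₂, bump, abs_mul, abs_of_nonneg (a := (1 + x ^ 2)⁻¹ ^ 3) (by positivity)]
  calc |6 * x ^ 2 - 2| * (1 + x ^ 2)⁻¹ ^ 3 ≤ 6 * (1 + x ^ 2) ^ 2 * (1 + x ^ 2)⁻¹ ^ 3 := by gcongr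
    _ = _ := by field_simp

/-- The bound follows from `s ^ 2 (1 + x ^ 2) ≤ 1 + (s x) ^ 2` and serves all `s` with one majorant.
The exponent 3/8 lies between 1/4, needed for square integrability, and 1/2, below which `s * bump
(s x)` retains a positive power of `s`. -/
theorem rpow_mul_bump_le {s : ℝ} (hs : 0 < s) (hs1 : s ≤ 1) (x : ℝ) :
    s ^ (3 / 4 : ℝ) * bump (s * x) ≤ bumpWeight x := by
  have h0 : (0 : ℝ) < 1 + x ^ 2 := by positivity
  have h1 : (0 : ℝ) < 1 + (s * x) ^ 2 := by positivity
  have h2 : s ^ (3 / 4 : ℝ) = (s ^ 2) ^ (3 / 8 : ℝ) := by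
    rw [← Real.rpow_natCast, ← Real.rpow_mul hs.le]
    norm_num
  have h3 : s ^ (3 / 4 : ℝ) * (1 + x ^ 2) ^ (3 / 8 : ℝ) ≤ 1 + (s * x) ^ 2 := by
    rw [h2, ← Real.mul_rpow (by positivity) h0.le]
    calc (s ^ 2 * (1 + x ^ 2)) ^ (3 / 8 : ℝ) ≤ (1 + (s * x) ^ 2) ^ (3 / 8 : ℝ) := by
          refine Real.rpow_le_rpow (by positivity) ?_ (by norm_num)
          nlinarith
      _ ≤ (1 + (s * x) ^ 2) ^ (1 : ℝ) :=
          Real.rpow_le_rpow_of_exponent_le (by nlinarith [sq_nonneg (s * x)]) (by norm_num)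
      _ = _ := Real.rpow_one _
  rw [bump, bumpWeight, Real.rpow_neg h0.le, ← div_eq_mul_inv, div_le_iff₀ h1,
    inv_mul_eq_div, le_div_iff₀ (by positivity)]
  exact h3

theorem bump_le_bumpWeight (x : ℝ) : bump x ≤ bumpWeight x := by
  simpa using rpow_mul_bump_le one_pos le_rfl x

theorem memLp_bumpWeight : MemLp bumpWeight 2 := by
  have hc : Continuous bumpWeight := by
    refine (by fun_prop : Continuous fun x : ℝ => 1 + x ^ 2).rpow_const fun x => Or.inl ?_
    positivity
  rw [memLp_two_iff_integrable_sq hc.aestronglyMeasurable]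
  have h := integrable_rpow_neg_one_add_norm_sq (E := ℝ) (μ := volume) (r := 3 / 2)
    (by norm_num)
  refine h.congr (ae_of_all _ fun x => ?_)
  have h0 : (0 : ℝ) ≤ 1 + x ^ 2 := by positivity
  simp only [bumpWeight, Real.norm_eq_abs, sq_abs]
  rw [← Real.rpow_natCast ((1 + x ^ 2) ^ (-(3 / 8) : ℝ)) 2, ← Real.rpow_mul h0]
  norm_num

theorem memLp_of_le_bumpWeight {h : ℝ → ℂ} (hc : ContinuousOn h (Set.Ici 0)) {C : ℝ}
    (hC : ∀ x, ‖h x‖ ≤ C * bumpWeight x) : MemLp h 2 (volume.restrict (Set.Ici 0)) := by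
  refine (memLp_bumpWeight.restrict (Set.Ici 0)).of_le_mul (c := C)
    (hc.aestronglyMeasurable measurableSet_Ici) (ae_of_all _ fun x => (hC x).trans_eq ?_)
  rw [Real.norm_of_nonneg]
  exact (bump_pos x).le.trans (bump_le_bumpWeight x)

end Bump

/-! ### The continuous spectrum -/

namespace SchrodingerGraph

section TotalFlux

variable {V E R : Type*} [Fintype V] [Fintype E] [Fintype R] [DecidableEq V]
  {Γ : SchrodingerGraph V E R}

/-- The flux through all rays of a function satisfying the vertex conditions, which solves the
homogeneous equation on the interior edges, vanishes. -/
theorem VertexConditions.sum_rays_eq_zero {lam : ℝ} {u u' : E ⊕ R → ℝ → ℂ}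
    (hv : Γ.VertexConditions u u')
    (hu : ∀ e, IsSolution (Γ.q (Sum.inl e)) lam (Γ.interval (Sum.inl e)) (u (Sum.inl e))
      (u' (Sum.inl e))) :
    ∑ r : R, (star (u (Sum.inr r) 0) * u' (Sum.inr r) 0 -
      star (u' (Sum.inr r) 0) * u (Sum.inr r) 0) = 0 := by
  have h1 := boundaryForm_eq_zero_of_forall_mem_bc hv
  unfold boundaryForm at h1
  rw [Fintype.sum_sum_type, Fintype.sum_sum_type, ← Finset.sum_add_distrib,
    Finset.sum_eq_zero (s := Finset.univ (α := E)), zero_add] at h1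
  · exact h1
  · intro e _
    have h2 := (hu e).conj.wronskian_eq (hu e) (Γ.ordConnected_interval _)
      (Γ.zero_mem_interval (Sum.inl e))
      (show Γ.len e ∈ Γ.interval (Sum.inl e) from ⟨(Γ.len_pos e).le, le_rfl⟩)
    simp only [boundaryData, star_neg]
    linear_combination h2

end TotalFlux

section ContinuousSpectrum

variable {V E R : Type*} [Fintype E] [Fintype R] [DecidableEq V] [DecidableEq E] [DecidableEq R]
  {Γ : SchrodingerGraph V E R}

/-- The embedding of the square integrable functions on a ray into the Hilbert space. -/
noncomputable def ofRay (Γ : SchrodingerGraph V E R) (r : R)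
    (g : Lp ℂ 2 (volume.restrict (Γ.interval (Sum.inr r)))) : Γ.HilbertSpace :=
  WithLp.toLp 2 (Pi.single (Sum.inr r) g)

/-- Extension by zero from a ray. -/
noncomputable def extendRay (r : R) (g : ℝ → ℂ) : E ⊕ R → ℝ → ℂ :=
  Pi.single (Sum.inr r) g

theorem continuous_ofRay (Γ : SchrodingerGraph V E R) (r : R) : Continuous (Γ.ofRay r) :=
  (PiLp.continuous_toLp 2 _).comp (continuous_single
    (A := fun i => Lp ℂ 2 (volume.restrict (Γ.interval i))) (Sum.inr r))

theorem ofRay_toLp_ae_eq (r : R) {g : ℝ → ℂ}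
    (hg : MemLp g 2 (volume.restrict (Γ.interval (Sum.inr r)))) (i : E ⊕ R) :
    (Γ.ofRay r (hg.toLp g) i : ℝ → ℂ) =ᵐ[volume.restrict (Γ.interval i)] extendRay r g i := by
  by_cases hi : i = Sum.inr r
  · subst hi
    simp only [ofRay, extendRay, Pi.single_eq_same]
    exact hg.coeFn_toLp
  · simp only [ofRay, extendRay, Pi.single_eq_of_ne hi]
    exact Lp.coeFn_zero ℂ 2 _

/-- A Jost solution on a ray, modulated by a function vanishing to first order at the vertex, lies
in the domain of the operator. -/
theorem operatorRel_ofRay (hΓ : Γ.RegularPotentials) {lam : ℝ} {r : R} {f f' : ℝ → ℂ}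
    (hf : IsSolution (Γ.q (Sum.inr r)) lam (Set.Ici 0) f f') {κ κ₁ κ₂ : ℝ → ℝ}
    (hκ : ∀ x, HasDerivAt κ (κ₁ x) x) (hκ₁ : ∀ x, HasDerivAt κ₁ (κ₂ x) x)
    (hκ₂ : Continuous κ₂) (h0 : κ 0 = 0) (h1 : κ₁ 0 = 0)
    (hm : MemLp (fun x => κ x * f x) 2 (volume.restrict (Γ.interval (Sum.inr r))))
    (hm' : MemLp (fun x => -(κ₂ x * f x + 2 * κ₁ x * f' x)) 2
      (volume.restrict (Γ.interval (Sum.inr r)))) :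
    Γ.OperatorRel (Γ.ofRay r (hm.toLp _))
      ((lam : ℂ) • Γ.ofRay r (hm.toLp _) + Γ.ofRay r (hm'.toLp _)) := by
  obtain ⟨F, hF, hfF⟩ := hf.2.2
  have hκc : Continuous κ := continuous_iff_continuousAt.2 fun x => (hκ x).continuousAt
  have hκ₁c : Continuous κ₁ := continuous_iff_continuousAt.2 fun x => (hκ₁ x).continuousAt
  have hcast : ∀ {p : ℝ → ℝ}, Continuous p → ContinuousOn (fun x => (p x : ℂ)) (Set.Ici 0) :=
    fun hp => (Complex.continuous_ofReal.comp hp).continuousOn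
  have hzero : ∀ (i : E ⊕ R) (g : ℝ → ℂ), i ≠ Sum.inr r → extendRay r g i = fun _ => 0 :=
    fun i g hi => Pi.single_eq_of_ne hi _
  have hself : ∀ g : ℝ → ℂ, extendRay r g (Sum.inr r : E ⊕ R) = g := fun g =>
    Pi.single_eq_same _ _
  refine operatorRel_of_classical hΓ (lam := lam)
    (u := extendRay r fun x => κ x * f x) (u' := extendRay r fun x => κ₁ x * f x + κ x * f' x)
    (g := extendRay r fun x => -(κ₂ x * f x + 2 * κ₁ x * f' x)) (fun i => ?_)
    (ofRay_toLp_ae_eq r hm) (fun i => ?_) (fun i => ?_) (fun i => ?_) (fun i => ?_) (fun v => ?_)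
  · by_cases hi : i = Sum.inr r
    · subst hi
      rw [hself]
      exact (((hcast hκ₂).mul hf.continuousOn).add
        ((continuousOn_const.mul (hcast hκ₁c)).mul hf.2.1)).neg
    · rw [hzero i _ hi]
      exact continuousOn_const
  · filter_upwards [ofRay_toLp_ae_eq r hm i, ofRay_toLp_ae_eq r hm' i,
      Lp.coeFn_smul (lam : ℂ) (Γ.ofRay r (hm.toLp _) i),
      Lp.coeFn_add ((lam : ℂ) • Γ.ofRay r (hm.toLp _) i) (Γ.ofRay r (hm'.toLp _) i)]
      with x h1 h2 h3 h4
    rw [PiLp.add_apply, PiLp.smul_apply, h4, Pi.add_apply, h3, Pi.smul_apply, h1, h2, smul_eq_mul]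
  · by_cases hi : i = Sum.inr r
    · subst hi
      rw [hself, hself]
      exact fun x hx => (hκ x).ofReal_comp.hasDerivWithinAt.mul (hf.1 x hx)
    · rw [hzero i _ hi, hzero i _ hi]
      exact fun x _ => hasDerivWithinAt_const x _ _
  · by_cases hi : i = Sum.inr r
    · subst hi
      rw [hself]
      exact ((hcast hκ₁c).mul hf.continuousOn).add ((hcast hκc).mul hf.2.1)
    · rw [hzero i _ hi]
      exact continuousOn_const
  · refine ⟨F, hF, ?_⟩
    by_cases hi : i = Sum.inr r
    · subst hi
      rw [hself, hself, hself]
      intro x hx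
      refine (((hκ₁ x).ofReal_comp.hasDerivWithinAt.mul (hf.1 x hx.1)).add
        ((hκ x).ofReal_comp.hasDerivWithinAt.mul (hfF x hx))).congr_deriv ?_
      ring
    · rw [hzero i _ hi, hzero i _ hi, hzero i _ hi]
      exact fun x _ => (hasDerivWithinAt_const x _ _).congr_deriv (by simp)
  · convert (Γ.bc v).zero_mem using 1
    funext ⟨h, hh⟩
    rcases h with (e | e) | r'
    · simp [boundaryData, extendRay]
    · simp [boundaryData, extendRay]
    · by_cases hr : r' = r
      · subst hr
        simp [boundaryData, hself, h0, h1]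
      · have : (Sum.inr r' : E ⊕ R) ≠ Sum.inr r := fun h => hr (Sum.inr_injective h)
        simp [boundaryData, hzero _ _ this]

variable [Fintype V]

/-- For a preimage `u`, the function `u + bump * f` solves the homogeneous equation on the ray `r`
and is square integrable, hence zero; on the other rays `u` itself is zero. At the vertex `u` has
the data of `-f`, so the total flux is $2ik$ instead of `0`. -/
theorem not_operatorRel_of_source (hΓ : Γ.RegularPotentials) {c : E → ℝ} {k : ℝ} (hk : k ≠ 0)
    {f f' : (E ⊕ E) ⊕ R → ℝ → ℂ} (hf : Γ.IsJostFamily c k f f') (r : R)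
    (hm : MemLp (fun x => bumpDeriv₂ x * f (Sum.inr r) x + 2 * bumpDeriv x * f' (Sum.inr r) x) 2
      (volume.restrict (Γ.interval (Sum.inr r)))) {ψ φ : Γ.HilbertSpace}
    (h : Γ.OperatorRel ψ φ) : φ - ((k ^ 2 : ℝ) : ℂ) • ψ ≠ Γ.ofRay r (hm.toLp _) := by
  intro hφ
  set fr := f (Sum.inr r) with hfr
  set fr' := f' (Sum.inr r) with hfr'
  have hJ : IsJostPair (Γ.q (Sum.inr r)) k fr fr' := hf (Sum.inr r)
  have hcast : ∀ {p : ℝ → ℝ}, Continuous p → ContinuousOn (fun x => (p x : ℂ)) (Set.Ici 0) :=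
    fun hp => (Complex.continuous_ofReal.comp hp).continuousOn
  have hzero : ∀ (i : E ⊕ R) (g : ℝ → ℂ), i ≠ Sum.inr r → extendRay r g i = fun _ => 0 :=
    fun i g hi => Pi.single_eq_of_ne hi _
  have hself : ∀ g : ℝ → ℂ, extendRay r g (Sum.inr r : E ⊕ R) = g := fun g =>
    Pi.single_eq_same _ _
  obtain ⟨u, u', hψu, hu, hu', hv⟩ := h.exists_classical hΓ (lam := k ^ 2)
    (g := extendRay r fun x => bumpDeriv₂ x * fr x + 2 * bumpDeriv x * fr' x) (fun i => by
      by_cases hi : i = Sum.inr r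
      · subst hi
        rw [hself]
        exact (((hcast continuous_bumpDeriv₂).mul hJ.sol.continuousOn).add
          ((continuousOn_const.mul (hcast continuous_bumpDeriv)).mul hJ.sol.2.1))
      · rw [hzero i _ hi]
        exact continuousOn_const) (fun i => by
      rw [sub_eq_iff_eq_add'] at hφ
      filter_upwards [ofRay_toLp_ae_eq r hm i, Lp.coeFn_smul ((k ^ 2 : ℝ) : ℂ) (ψ i),
        Lp.coeFn_add (((k ^ 2 : ℝ) : ℂ) • ψ i) (Γ.ofRay r (hm.toLp _) i)] with x h1 h2 h3
      rw [hφ, PiLp.add_apply, PiLp.smul_apply, h3, Pi.add_apply, h2, Pi.smul_apply, h1,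
        smul_eq_mul])
  have hsol : ∀ i, i ≠ Sum.inr r → IsSolution (Γ.q i) (k ^ 2) (Γ.interval i) (u i) (u' i) :=
    fun i hi => ⟨hu i, fun x hx => (hu' i x hx).continuousWithinAt, ∅, Set.finite_empty,
      fun x hx => by
        have := hu' i x hx.1
        rw [hzero i _ hi] at this
        simpa using this⟩
  have hray : ∀ r', r' ≠ r → ∀ x, 0 ≤ x → u (Sum.inr r') x = 0 ∧ u' (Sum.inr r') x = 0 :=
    fun r' hr' => hf.eq_zero_of_sq_integrable hk
      (hsol (Sum.inr r') fun h => hr' (Sum.inr_injective h))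
      (integrableOn_norm_sq_of_ae_eq (ψ (Sum.inr r')) (hψu _))
  obtain ⟨F, hF, hfF⟩ := hJ.sol.2.2
  have hsolr : IsSolution (Γ.q (Sum.inr r)) (k ^ 2) (Set.Ici 0)
      (fun x => u (Sum.inr r) x + bump x * fr x)
      (fun x => u' (Sum.inr r) x + (bumpDeriv x * fr x + bump x * fr' x)) := by
    refine ⟨fun x hx => (hu (Sum.inr r) x hx).add
      ((hasDerivAt_bump x).ofReal_comp.hasDerivWithinAt.mul (hJ.sol.1 x hx)), ?_, F, hF,
      fun x hx => ?_⟩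
    · exact ContinuousOn.add (fun x hx => (hu' (Sum.inr r) x hx).continuousWithinAt)
        (((hcast continuous_bumpDeriv).mul hJ.sol.continuousOn).add
          ((hcast continuous_bump).mul hJ.sol.2.1))
    · have h1 := hu' (Sum.inr r) x hx.1
      rw [hself] at h1
      refine (h1.add (((hasDerivAt_bumpDeriv x).ofReal_comp.hasDerivWithinAt.mul
        (hJ.sol.1 x hx.1)).add ((hasDerivAt_bump x).ofReal_comp.hasDerivWithinAt.mul
        (hfF x hx)))).congr_deriv ?_
      ring
  obtain ⟨C, hC⟩ := hJ.bdd
  have hC0 : 0 ≤ C := (norm_nonneg _).trans (hC 0).1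
  have hbm : MemLp (fun x => bump x * fr x) 2 (volume.restrict (Set.Ici 0)) := by
    refine memLp_of_le_bumpWeight ((hcast continuous_bump).mul hJ.sol.continuousOn) (C := C)
      fun x => ?_
    rw [norm_mul, Complex.norm_real, Real.norm_of_nonneg (bump_pos x).le, mul_comm C]
    exact mul_le_mul (bump_le_bumpWeight x) (hC x).1 (norm_nonneg _)
      ((bump_pos x).le.trans (bump_le_bumpWeight x))
  have hum : MemLp (u (Sum.inr r)) 2 (volume.restrict (Set.Ici 0)) :=
    (memLp_congr_ae (hψu (Sum.inr r))).1 (Lp.memLp (ψ (Sum.inr r)))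
  have h0 := hf.eq_zero_of_sq_integrable hk hsolr
    ((hum.add hbm).integrable_norm_pow two_ne_zero) 0 le_rfl
  -- Value 1 and slope 0 at the vertex give `bump * f` exactly the boundary data of `f`.
  have hb0 : bump 0 = 1 := by simp [bump]
  have hb1 : bumpDeriv 0 = 0 := by simp [bumpDeriv]
  simp only [hb0, hb1, Complex.ofReal_one, Complex.ofReal_zero, one_mul, zero_mul, zero_add] at h0
  have h1 := hv.sum_rays_eq_zero (lam := k ^ 2) fun e => hsol (Sum.inl e) Sum.inl_ne_inr
  rw [Finset.sum_eq_single r (fun r' _ hr' => by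
      rw [(hray r' hr' 0 le_rfl).1, (hray r' hr' 0 le_rfl).2]
      simp) (by simp), eq_neg_of_add_eq_zero_left h0.1, eq_neg_of_add_eq_zero_left h0.2] at h1
  have h2 := hJ.wronskian (le_refl (0 : ℝ))
  have h3 : (2 * Complex.I * k : ℂ) = 0 := by
    rw [← h2]
    simpa using h1
  simp [hk] at h3

/-- The source of `not_operatorRel_of_source` is outside the range but in its closure: it is the
limit of `src 1 - src s` as `s → 0`. -/
theorem sq_mem_continuousSpectrum [Nonempty R] (hΓ : Γ.RegularPotentials) {c : E → ℝ} {k : ℝ}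
    (hk : k ≠ 0) {f f' : (E ⊕ E) ⊕ R → ℝ → ℂ} (hf : Γ.IsJostFamily c k f f') :
    k ^ 2 ∈ Γ.continuousSpectrum := by
  intro hclosed
  obtain ⟨r⟩ := ‹Nonempty R›
  set fr := f (Sum.inr r) with hfr
  set fr' := f' (Sum.inr r) with hfr'
  have hJ : IsJostPair (Γ.q (Sum.inr r)) k fr fr' := hf (Sum.inr r)
  obtain ⟨C, hC⟩ := hJ.bdd
  have hC0 : 0 ≤ C := (norm_nonneg _).trans (hC 0).1
  have hcast : ∀ {p : ℝ → ℝ}, Continuous p → ContinuousOn (fun x => (p x : ℂ)) (Set.Ici 0) :=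
    fun hp => (Complex.continuous_ofReal.comp hp).continuousOn
  -- the rescaled bump and its derivatives
  have hd : ∀ s x : ℝ, HasDerivAt (fun x => bump (s * x)) (s * bumpDeriv (s * x)) x :=
    fun s x => by
      have := (hasDerivAt_bump (s * x)).comp x ((hasDerivAt_id x).const_mul s)
      exact this.congr_deriv (by ring)
  have hd₁ : ∀ s x : ℝ, HasDerivAt (fun x => s * bumpDeriv (s * x))
      (s ^ 2 * bumpDeriv₂ (s * x)) x := fun s x => by
    have := ((hasDerivAt_bumpDeriv (s * x)).comp x ((hasDerivAt_id x).const_mul s)).const_mul s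
    refine this.congr_deriv ?_
    ring
  have hd₂ : ∀ s : ℝ, Continuous fun x => s ^ 2 * bumpDeriv₂ (s * x) := fun s =>
    continuous_const.mul (continuous_bumpDeriv₂.comp (continuous_const.mul continuous_id))
  have hd₁c : ∀ s : ℝ, Continuous fun x => s * bumpDeriv (s * x) := fun s =>
    continuous_iff_continuousAt.2 fun x => (hd₁ s x).continuousAt
  have hdc : ∀ s : ℝ, Continuous fun x => bump (s * x) := fun s =>
    continuous_iff_continuousAt.2 fun x => (hd s x).continuousAt
  set src : ℝ → ℝ → ℂ := fun s x => ((s ^ 2 * bumpDeriv₂ (s * x) : ℝ) : ℂ) * fr x +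
    2 * ((s * bumpDeriv (s * x) : ℝ) : ℂ) * fr' x with hsrc
  have hsrcc : ∀ s, ContinuousOn (src s) (Set.Ici 0) := fun s =>
    ((hcast (hd₂ s)).mul hJ.sol.continuousOn).add
      ((continuousOn_const.mul (hcast (hd₁c s))).mul hJ.sol.2.1)
  -- The constant 8 is 6 from the second derivative plus 2 from the cross term; `s ^ 2 ≤ s` is used
  -- in the former. Splitting `s = s ^ (1/4) * s ^ (3/4)` leaves a factor tending to zero.
  have hsrcle : ∀ s, 0 < s → s ≤ 1 → ∀ x,
      ‖src s x‖ ≤ 8 * C * s ^ (1 / 4 : ℝ) * bumpWeight x := by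
    intro s hs hs1 x
    have hb := (bump_pos (s * x)).le
    have h1 : ‖((s ^ 2 * bumpDeriv₂ (s * x) : ℝ) : ℂ) * fr x‖ ≤ s * (6 * bump (s * x)) * C := by
      rw [norm_mul, Complex.norm_real, norm_mul, Real.norm_of_nonneg (sq_nonneg s)]
      refine mul_le_mul (mul_le_mul (by nlinarith) (abs_bumpDeriv₂_le _) (norm_nonneg _) hs.le)
        (hC x).1 (norm_nonneg _) (by positivity)
    have h2 : ‖2 * ((s * bumpDeriv (s * x) : ℝ) : ℂ) * fr' x‖ ≤ 2 * (s * bump (s * x)) * C := by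
      rw [norm_mul, norm_mul, Complex.norm_real, norm_mul, Real.norm_of_nonneg hs.le,
        Complex.norm_ofNat]
      refine mul_le_mul (mul_le_mul_of_nonneg_left (mul_le_mul_of_nonneg_left
        (abs_bumpDeriv_le _) hs.le) (by norm_num)) (hC x).2 (norm_nonneg _) (by positivity)
    have h3 : s = s ^ (1 / 4 : ℝ) * s ^ (3 / 4 : ℝ) := by
      rw [← Real.rpow_add hs]
      norm_num
    have h4 : s * bump (s * x) ≤ s ^ (1 / 4 : ℝ) * bumpWeight x := by
      calc s * bump (s * x) = s ^ (1 / 4 : ℝ) * (s ^ (3 / 4 : ℝ) * bump (s * x)) := by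
            rw [← mul_assoc, ← h3]
        _ ≤ _ := mul_le_mul_of_nonneg_left (rpow_mul_bump_le hs hs1 x) (by positivity)
    calc ‖src s x‖ ≤ s * (6 * bump (s * x)) * C + 2 * (s * bump (s * x)) * C :=
          (norm_add_le _ _).trans (add_le_add h1 h2)
      _ = 8 * C * (s * bump (s * x)) := by ring
      _ ≤ 8 * C * (s ^ (1 / 4 : ℝ) * bumpWeight x) :=
          mul_le_mul_of_nonneg_left h4 (by positivity)
      _ = _ := by ring
  have hsrcm : ∀ s, 0 < s → s ≤ 1 → MemLp (src s) 2 (volume.restrict (Set.Ici 0)) :=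
    fun s hs hs1 => memLp_of_le_bumpWeight (hsrcc s) (hsrcle s hs hs1)
  set sc : ℕ → ℝ := fun n => 1 / ((n : ℝ) + 1) with hscd
  have hsc0 : ∀ n, 0 < sc n := fun n => by positivity
  have hsc1 : ∀ n, sc n ≤ 1 := fun n => by
    rw [hscd]
    exact div_le_one_of_le₀ (by linarith [(n.cast_nonneg : (0 : ℝ) ≤ n)]) (by positivity)
  have hone : src 1 = fun x => bumpDeriv₂ x * fr x + 2 * bumpDeriv x * fr' x := by
    funext x
    simp [hsrc]
  have hm1 : MemLp (fun x => bumpDeriv₂ x * fr x + 2 * bumpDeriv x * fr' x) 2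
      (volume.restrict (Γ.interval (Sum.inr r))) := hone ▸ hsrcm 1 one_pos le_rfl
  have hmn : ∀ n, MemLp (src (sc n)) 2 (volume.restrict (Γ.interval (Sum.inr r))) := fun n =>
    hsrcm _ (hsc0 n) (hsc1 n)
  -- the elements of the range
  have hrange : ∀ n, ∃ ψ φ : Γ.HilbertSpace, Γ.OperatorRel ψ φ ∧
      φ - ((k ^ 2 : ℝ) : ℂ) • ψ = Γ.ofRay r (hm1.toLp _ - (hmn n).toLp _) := by
    intro n
    set s := sc n with hs
    have hkm : MemLp (fun x => ((bump (s * x) - bump (1 * x) : ℝ) : ℂ) * fr x) 2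
        (volume.restrict (Set.Ici 0)) := by
      refine memLp_of_le_bumpWeight ((hcast ((hdc s).sub (hdc 1))).mul hJ.sol.continuousOn)
        (C := ((s ^ (3 / 4 : ℝ))⁻¹ + 1) * C) fun x => ?_
      have hp : 0 < s ^ (3 / 4 : ℝ) := Real.rpow_pos_of_pos (hsc0 n) _
      have h1 : bump (s * x) ≤ (s ^ (3 / 4 : ℝ))⁻¹ * bumpWeight x := by
        rw [inv_mul_eq_div, le_div_iff₀ hp, mul_comm]
        exact rpow_mul_bump_le (hsc0 n) (hsc1 n) x
      have h2 : |bump (s * x) - bump (1 * x)| ≤ ((s ^ (3 / 4 : ℝ))⁻¹ + 1) * bumpWeight x := by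
        rw [one_mul]
        refine (abs_sub _ _).trans ?_
        rw [abs_of_pos (bump_pos _), abs_of_pos (bump_pos _), add_mul, one_mul]
        exact add_le_add h1 (bump_le_bumpWeight x)
      rw [norm_mul, Complex.norm_real, Real.norm_eq_abs]
      calc _ ≤ ((s ^ (3 / 4 : ℝ))⁻¹ + 1) * bumpWeight x * C :=
            mul_le_mul h2 (hC x).1 (norm_nonneg _) ((abs_nonneg _).trans h2)
        _ = _ := by ring
    have hdiff : (fun x => -(((s ^ 2 * bumpDeriv₂ (s * x) - 1 ^ 2 * bumpDeriv₂ (1 * x) : ℝ) : ℂ) *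
        fr x + 2 * ((s * bumpDeriv (s * x) - 1 * bumpDeriv (1 * x) : ℝ) : ℂ) * fr' x)) =
        (fun x => bumpDeriv₂ x * fr x + 2 * bumpDeriv x * fr' x) - src s := by
      funext x
      simp only [hsrc, Pi.sub_apply, one_mul, one_pow]
      push_cast
      ring
    have hdm := hm1.sub (hmn n)
    have hrel := operatorRel_ofRay hΓ (r := r) hJ.sol (κ := fun x => bump (s * x) - bump (1 * x))
      (κ₁ := fun x => s * bumpDeriv (s * x) - 1 * bumpDeriv (1 * x))
      (κ₂ := fun x => s ^ 2 * bumpDeriv₂ (s * x) - 1 ^ 2 * bumpDeriv₂ (1 * x))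
      (fun x => (hd s x).sub (hd 1 x)) (fun x => (hd₁ s x).sub (hd₁ 1 x))
      ((hd₂ s).sub (hd₂ 1)) (by simp) (by simp [bumpDeriv]) hkm (hdiff ▸ hdm)
    refine ⟨_, _, hrel, ?_⟩
    rw [add_sub_cancel_left]
    congr 1
    rw [← MemLp.toLp_sub]
    exact MemLp.toLp_congr _ _ (by rw [hdiff])
  have htend : Tendsto (fun n => hm1.toLp _ - (hmn n).toLp _) atTop (𝓝 (hm1.toLp _)) := by
    have hw := memLp_bumpWeight.restrict (Γ.interval (Sum.inr r))
    have h1 : Tendsto (fun n => (hmn n).toLp (src (sc n))) atTop (𝓝 0) := by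
      have h2 : ∀ n, ‖(hmn n).toLp (src (sc n))‖ ≤
          8 * C * sc n ^ (1 / 4 : ℝ) * ‖hw.toLp bumpWeight‖ := fun n => by
        refine Lp.norm_le_mul_norm_of_ae_le_mul ?_
        filter_upwards [(hmn n).coeFn_toLp, hw.coeFn_toLp] with x h1 h2
        rw [h1, h2, Real.norm_of_nonneg ((bump_pos x).le.trans (bump_le_bumpWeight x))]
        exact hsrcle _ (hsc0 n) (hsc1 n) x
      refine squeeze_zero_norm h2 ?_
      have h3 : Tendsto (fun n => sc n ^ (1 / 4 : ℝ)) atTop (𝓝 0) := by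
        have h4 := (tendsto_one_div_add_atTop_nhds_zero_nat (𝕜 := ℝ)).rpow_const
          (p := (1 / 4 : ℝ)) (Or.inr (by norm_num))
        rwa [Real.zero_rpow (by norm_num)] at h4
      simpa using (h3.const_mul (8 * C)).mul_const ‖hw.toLp bumpWeight‖
    simpa using h1.const_sub (hm1.toLp _)
  obtain ⟨ψ, φ, hrel, hφ⟩ := hclosed.mem_of_tendsto
    (((Γ.continuous_ofRay r).tendsto _).comp htend) (Eventually.of_forall hrange)
  exact not_operatorRel_of_source hΓ hk hf r hm1 hrel hφ

end ContinuousSpectrum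

end SchrodingerGraph

theorem mainTheorem6 {V E R : Type*} [Fintype V] [Fintype E] [Fintype R] [Nonempty R]
    [DecidableEq V] [DecidableEq E] [DecidableEq R]
    (Γ : SchrodingerGraph V E R) (hΓ : Γ.RegularPotentials)
    (c : E → ℝ) (hc : ∀ e, c e ∈ Set.Icc 0 (Γ.len e)) (k : ℝ) (hk : k ≠ 0) :
    (∀ v : V, ∃! S, (Γ.vertexStar c v).IsScatteringMatrix k S) ∧
    k ^ 2 ∈ Γ.continuousSpectrum ∧
    ∀ S : ∀ v : V, Matrix {h : (E ⊕ E) ⊕ R // Γ.vtx h = v} {h : (E ⊕ E) ⊕ R // Γ.vtx h = v} ℂ,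
      (∀ v, (Γ.vertexStar c v).IsScatteringMatrix k (S v)) →
        ((Γ.matrixB k S).det = 0 ↔ Γ.IsEmbeddedEigenvalue (k ^ 2)) := by
  obtain ⟨f, f', hf⟩ := hΓ.exists_isJostFamily hc hk
  have hcs := SchrodingerGraph.sq_mem_continuousSpectrum hΓ hk hf
  refine ⟨SchrodingerGraph.existsUnique_isScatteringMatrix_vertexStar hk hf, hcs, fun S hS => ?_⟩
  rw [SchrodingerGraph.det_matrixB_eq_zero_iff hk hf hS,
    ← SchrodingerGraph.isEigenvalue_iff hΓ hc hk hf]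
  exact ⟨fun h => ⟨h, hcs⟩, fun h => h.1⟩
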